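/- **Conventions.** All graphs are finite and simple. For a graph $G=(V,E)$ and $A,B\subseteq V$ let $I_G(A,B)$ be the set of edges with one end in $A$ and the other in $B$, $I_G(A)=I_G(A,A)$, and $I_G(m)=\max_{|S|=m}|I_G(S)|$. A set $A$ is *optimal* if $|I_G(A)|=I_G(|A|)$ (it solves the Induced Edges problem). A total order on $V$ is *optimal* if all its initial segments are optimal sets; $G$ is *isoperimetric* if it has an optimal order. Let $\delta_G(m)=I_G(m)-I_G(m-1)$ for $1\le m\le |V|$; the $\delta$-sequence of $G$ is $\delta_G=(\delta_G(1),\dots,\delta_G(|V|))$. Let $G$ be isoperimetric with a fixed optimal order $\mathcal O=\mathcal O_G$, regarded as a bijection $V\to\{1,\dots,|V|\}$, and write $\mathcal O[a,b]=\mathcal O^{-1}(\{a,\dots,b\})$. A partition $\mathfrak P_G=\{\mathcal O[a_1,b_1]<\dots<\mathcal O[a_n,b_n]\}$ of $V$ into nonempty intervals of $\mathcal O$ is * *isoperimetric* if for every $i$ the order inherited from $\mathcal O$ is optimal for the graph induced by $\mathcal O[a_i,b_i]$, and $|I_G(\mathcal O[a_1,b_{i-1}],\{v\})|=\delta_G(a_i)$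 for every $v\in\mathcal O[a_i,b_i]$ (for $i=1$ the set $\mathcal O[a_1,b_{i-1}]$ is empty); * *non-decreasing* if for every $i$ the $\delta$-sequence of the graph induced by $\mathcal O[a_i,b_i]$ is non-decreasing; * *regular* if the graphs induced by $\mathcal O[a_1,b_1]$ and by $\mathcal O[a_n,b_n]$ have the same $\delta$-sequence. The *start* of $\mathcal O[a_i,b_i]$ is its first vertex. Let $G_1,\dots,G_d$ be isoperimetric graphs with fixed optimal orders $\mathcal O_{G_i}$ and isoperimetric partitions $\mathfrak P_{G_i}$. For nonempty $S=\{i_1<\dots<i_k\}\subseteq\{1,\dots,d\}$ let $G_S=G_{i_1}\square\cdots\square G_{i_k}$ (Cartesian product). A *block* of $G_S$ is a product $Z_{i_1}\times\cdots\times Z_{i_k}$ with $Z_{i_j}\in\mathfrak P_{G_{i_j}}$; its *start* is the vertex whose coordinates are the starts of the $Z_{i_j}$. The lexicographic order on vertices of $G_S$ compares the tuples of the positions of their coordinates in the orders $\mathcal O_{G_{i_j}}$ lexicographically; for a permutation $\pi$ of $\{1,\dots,k\}$ the *domination order* given by $\pi$ compares these tuples lexicographically after rearranging each tuple $(x_1,\dots,x_k)$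 to $(x_{\pi(1)},\dots,x_{\pi(k)})$. A *domination collection* consists of a domination order $\mathcal D_B$ (given by some permutation) on each block $B$ of each subproduct $G_S$, $S\ne\emptyset$, such that 1. $\mathcal D_B$ is optimal for the subgraph of $G_S$ induced by $B$; 2. if $\emptyset\neq S_1\subseteq S_2$, $B$ is a block of $G_{S_2}$ and $B'$ is its projection to $G_{S_1}$, then for all $x,y\in B$ that agree in all coordinates outside $S_1$, $x<_{\mathcal D_B}y$ implies that the projections satisfy $x'<_{\mathcal D_{B'}}y'$. For $d\ge3$ it is *regular* if $\mathfrak P_{G_i}$ is regular for $i=2,\dots,d-1$ and, for $S=\{2,\dots,d-1\}$, the domination orders on the product $B_1$ of the first parts and on the product $B_2$ of the last parts of $\mathfrak P_{G_2},\dots,\mathfrak P_{G_{d-1}}$ are the same, i.e. they are induced by a common permutation. Given a domination collection, the *block-lexicographic order* $\mathcal{BL}^k_{G_S}$ on $G_S$ is defined as follows: if $u,v$ lie in the same block $B$, then $u<v$ iff $u<_{\mathcal D_B}v$; if they lie in different blocks with starts $z_u,z_v$, then $u<v$ iff $z_u$ precedes $z_v$ in the lexicographic order. **Theorem.** Let $d\ge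 3$, let $G_1,\dots,G_d$ be isoperimetric graphs with fixed optimal orders and with isoperimetric partitions $\mathfrak P_{G_1},\dots,\mathfrak P_{G_d}$, and let a domination collection for them be given. Suppose that 1. $\mathfrak P_{G_i}$ is non-decreasing for $i=1,\dots,d-1$; 2. the domination collection is regular; 3. the order $\mathcal{BL}^2_{G_i\square G_j}$ is optimal for all $1\le i<j\le d$. Then $\mathcal{BL}^d_G$ is an optimal order for $G=G_1\square\cdots\square G_d$; that is, $\mathcal{BL}^d_G$ is a total order on the vertices of $G$, and each of its initial segments induces the maximum number of edges among all vertex sets of the same size. -/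

import Mathlib

namespace EdgeIso

universe u

/-- `I_G(A, B)`: the edges of `G` with one end in `A` and the other one in `B`. -/
def edgesBetween {V : Type u} (G : SimpleGraph V) (A B : Set V) : Set (Sym2 V) :=
  {e | e ∈ G.edgeSet ∧ ∃ a ∈ A, ∃ b ∈ B, e = s(a, b)}

/-- `|I_G(A)|`: the number of edges of `G` induced by `A`. -/
noncomputable def numInduced {V : Type u} (G : SimpleGraph V) (A : Set V) : ℕ :=
  (edgesBetween G A A).ncard

/-- `I_G(m)`: the maximum of `|I_G(S)|` over all `S` with `m` vertices (for `m ≤ |V|`). -/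
noncomputable def maxInduced {V : Type u} [Fintype V] (G : SimpleGraph V) (m : ℕ) : ℕ :=
  (Finset.powersetCard m (Finset.univ : Finset V)).sup fun S => numInduced G (S : Set V)

/-- `A` solves the Induced Edges problem for `m = |A|`. -/
def IsOptimal {V : Type u} [Fintype V] (G : SimpleGraph V) (A : Finset V) : Prop :=
  numInduced G (A : Set V) = maxInduced G A.card

/-- `r` is a (strict) total order on the vertices all of whose initial segments are optimal sets. -/
structure IsOptimalOrder {V : Type u} [Fintype V] (G : SimpleGraph V) (r : V → V → Prop) :
    Prop where
  strictTotal : IsStrictTotalOrder V r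
  optimal : ∀ A : Finset V, (∀ a b, r a b → b ∈ A → a ∈ A) → IsOptimal G A

/-- `δ_G(m) = I_G(m) - I_G(m - 1)`, for `1 ≤ m ≤ |V|`. -/
noncomputable def delta {V : Type u} [Fintype V] (G : SimpleGraph V) (m : ℕ) : ℤ :=
  (maxInduced G m : ℤ) - (maxInduced G (m - 1) : ℤ)

/-- The `δ`-sequence `(δ_G(1), …, δ_G(|V|))`. -/
noncomputable def deltaSeq {V : Type u} [Fintype V] (G : SimpleGraph V) : List ℤ :=
  List.ofFn fun r : Fin (Fintype.card V) => delta G ((r : ℕ) + 1)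

/-- The order of the vertices given by a numbering `η` of the vertices (numbers start at `0`). -/
def rankLT {V : Type u} [Fintype V] (η : V ≃ Fin (Fintype.card V)) (a b : V) : Prop :=
  η a < η b

/-- A partition of the vertices into nonempty sets of consecutive vertices of the order `η`, the
parts being numbered in increasing order; `part v` is the number of the part that contains `v`. -/
structure OrderedPartition {V : Type u} [Fintype V] (η : V ≃ Fin (Fintype.card V)) where
  numParts : ℕ
  part : V → Fin numParts
  surj : Function.Surjective part
  mono : ∀ a b, η a ≤ η b → part a ≤ part b

namespace OrderedPartition

variable {V : Type u} [Fintype V] {η : V ≃ Fin (Fintype.card V)}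

/-- The `j`-th part. -/
def cell (P : OrderedPartition η) (j : Fin P.numParts) : Set V := {v | P.part v = j}

instance (P : OrderedPartition η) (j : Fin P.numParts) : Fintype (P.cell j) :=
  inferInstanceAs (Fintype {v // P.part v = j})

/-- The start of the `j`-th part: its first vertex. -/
noncomputable def start (P : OrderedPartition η) (j : Fin P.numParts) : V :=
  Function.argminOn (fun v => η v) (P.cell j) (P.surj j)

/-- Isoperimetric partitions: every part induces a graph for which the inherited order is optimal,
and every vertex of a part `O[a, b]` has exactly `δ_G(a)` neighbours in the earlier parts. -/
structure IsIsoperimetric (G : SimpleGraph V) (P : OrderedPartition η) : Prop where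
  optimal : ∀ j, IsOptimalOrder (G.induce (P.cell j)) fun a b => rankLT η a.1 b.1
  cross : ∀ j, ∀ v ∈ P.cell j,
    ((edgesBetween G {a | P.part a < j} {v}).ncard : ℤ) = delta G ((η (P.start j) : ℕ) + 1)

/-- The `δ`-sequence of the graph induced by every part is non-decreasing. -/
def IsNonDecreasing (G : SimpleGraph V) (P : OrderedPartition η) : Prop :=
  ∀ j, (deltaSeq (G.induce (P.cell j))).Pairwise (· ≤ ·)

/-- The graphs induced by the first and by the last part have the same `δ`-sequence. -/
def IsRegular (G : SimpleGraph V) (P : OrderedPartition η) : Prop :=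
  ∀ j l : Fin P.numParts, (j : ℕ) = 0 → (l : ℕ) + 1 = P.numParts →
    deltaSeq (G.induce (P.cell j)) = deltaSeq (G.induce (P.cell l))

end OrderedPartition

/-- The Cartesian product `G_1 □ ⋯ □ G_k`. -/
def boxPi {k : ℕ} {V : Fin k → Type u} (G : ∀ i, SimpleGraph (V i)) :
    SimpleGraph (∀ i, V i) where
  Adj x y := ∃ i, (G i).Adj (x i) (y i) ∧ ∀ j, j ≠ i → x j = y j
  symm := ⟨fun _ _ ⟨i, h, h'⟩ => ⟨i, h.symm, fun j hj => (h' j hj).symm⟩⟩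
  loopless := ⟨fun _ ⟨i, h, _⟩ => (G i).loopless.irrefl _ h⟩

/-- The lexicographic order on `k`-tuples. -/
def lexLT {k : ℕ} (x y : Fin k → ℕ) : Prop :=
  Pi.Lex (· < ·) (fun {_} a b => a < b) x y

/-- The domination order given by `π`: the tuples `(x_{π(1)}, …, x_{π(k)})` are compared
lexicographically. -/
def domLT {k : ℕ} (π : Equiv.Perm (Fin k)) (x y : Fin k → ℕ) : Prop :=
  lexLT (fun i => x (π i)) (fun i => y (π i))

section Product

/-! A nonempty set `S = {i_1 < ⋯ < i_k}` of coordinates is given by the increasing embedding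
`e : Fin k ↪o Fin d` that enumerates it, and the subproduct `G_S` has the vertex set
`∀ j, V (e j)`. -/

variable {d : ℕ} {V : Fin d → Type u} [∀ i, Fintype (V i)]
  {η : ∀ i, V i ≃ Fin (Fintype.card (V i))}

/-- The tuple of the numbers of the coordinates of a vertex of `G_S`. -/
def ranks (η : ∀ i, V i ≃ Fin (Fintype.card (V i))) {k : ℕ} (e : Fin k ↪o Fin d)
    (x : ∀ j, V (e j)) : Fin k → ℕ :=
  fun j => (η (e j) (x j) : ℕ)

/-- The index of a block of `G_S`: the choice of a part of the partition of every factor. -/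
abbrev BlockIndex (P : ∀ i, OrderedPartition (η i)) {k : ℕ} (e : Fin k ↪o Fin d) : Type :=
  ∀ j, Fin (P (e j)).numParts

/-- The block `Z_1 × ⋯ × Z_k` of `G_S`. -/
def block (P : ∀ i, OrderedPartition (η i)) {k : ℕ} (e : Fin k ↪o Fin d)
    (Z : BlockIndex P e) : Set (∀ j, V (e j)) :=
  {x | ∀ j, (P (e j)).part (x j) = Z j}

instance (P : ∀ i, OrderedPartition (η i)) {k : ℕ} (e : Fin k ↪o Fin d)
    (Z : BlockIndex P e) : Fintype (block P e Z) :=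
  inferInstanceAs (Fintype {x : ∀ j, V (e j) // ∀ j, (P (e j)).part (x j) = Z j})

/-- The index of the block that contains `x`. -/
def blockOf (P : ∀ i, OrderedPartition (η i)) {k : ℕ} (e : Fin k ↪o Fin d)
    (x : ∀ j, V (e j)) : BlockIndex P e :=
  fun j => (P (e j)).part (x j)

/-- The start of a block. -/
noncomputable def blockStart (P : ∀ i, OrderedPartition (η i)) {k : ℕ} (e : Fin k ↪o Fin d)
    (Z : BlockIndex P e) : ∀ j, V (e j) :=
  fun j => (P (e j)).start (Z j)

/-- A domination collection: a permutation for every block of every subproduct `G_S`, such that the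
domination order given by it is optimal for the graph induced by the block, and such that for
`S₁ ⊆ S₂` the domination order on a block of `G_{S₂}` is consistent with the domination order on its
projection, a block of `G_{S₁}`. -/
structure DominationCollection (G : ∀ i, SimpleGraph (V i)) (P : ∀ i, OrderedPartition (η i)) where
  perm : ∀ {k : ℕ} (e : Fin k ↪o Fin d), BlockIndex P e → Equiv.Perm (Fin k)
  optimal : ∀ {k : ℕ} (_ : 0 < k) (e : Fin k ↪o Fin d) (Z : BlockIndex P e),
    IsOptimalOrder ((boxPi fun j => G (e j)).induce (block P e Z)) fun x y =>
      domLT (perm e Z) (ranks η e x.1) (ranks η e y.1)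
  consistent : ∀ {k₁ k₂ : ℕ} (_ : 0 < k₁) (f : Fin k₁ ↪o Fin k₂) (e : Fin k₂ ↪o Fin d)
    (Z : BlockIndex P e), ∀ x ∈ block P e Z, ∀ y ∈ block P e Z,
      (∀ j, j ∉ Set.range f → x j = y j) →
      domLT (perm e Z) (ranks η e x) (ranks η e y) →
      domLT (perm (f.trans e) fun j => Z (f j))
        (ranks η (f.trans e) fun j => x (f j)) (ranks η (f.trans e) fun j => y (f j))

/-- The block-lexicographic order on `G_S`: two vertices of the same block are compared by the
domination order of the block, and two vertices of different blocks by the lexicographic order of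
the starts of these blocks. -/
def blockLexLT {G : ∀ i, SimpleGraph (V i)} {P : ∀ i, OrderedPartition (η i)}
    (D : DominationCollection G P) {k : ℕ} (e : Fin k ↪o Fin d) (x y : ∀ j, V (e j)) : Prop :=
  (blockOf P e x = blockOf P e y ∧
      domLT (D.perm e (blockOf P e x)) (ranks η e x) (ranks η e y)) ∨
    (blockOf P e x ≠ blockOf P e y ∧
      lexLT (ranks η e (blockStart P e (blockOf P e x)))
        (ranks η e (blockStart P e (blockOf P e y))))

/-- The set of all coordinates except the first one and the last one. -/
def middle (d : ℕ) : Fin (d - 2) ↪o Fin d :=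
  OrderEmbedding.ofStrictMono (fun j => ⟨(j : ℕ) + 1, by omega⟩) fun _ _ h =>
    Nat.add_lt_add_right (show _ from h) 1

/-- Regular domination collections: the partitions of all factors except the first one and the last
one are regular, and on the blocks `B₁` and `B₂` that are the products of the first parts and of the
last parts of these partitions, the domination orders are the same, that is, they are induced by one
permutation `τ`. -/
structure DominationCollection.IsRegular {G : ∀ i, SimpleGraph (V i)}
    {P : ∀ i, OrderedPartition (η i)} (D : DominationCollection G P) : Prop where
  regular : ∀ i : Fin d, 0 < (i : ℕ) → (i : ℕ) + 1 < d → (P i).IsRegular (G i)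
  same_order : ∀ B₁ B₂ : BlockIndex P (middle d), (∀ j, (B₁ j : ℕ) = 0) →
    (∀ j, (B₂ j : ℕ) + 1 = (P (middle d j)).numParts) →
    ∃ τ : Equiv.Perm (Fin (d - 2)), ∀ B, B = B₁ ∨ B = B₂ →
      ∀ x ∈ block P (middle d) B, ∀ y ∈ block P (middle d) B,
        (domLT (D.perm (middle d) B) (ranks η (middle d) x) (ranks η (middle d) y) ↔
          domLT τ (ranks η (middle d) x) (ranks η (middle d) y))

end Product

end EdgeIso

open EdgeIso

/-! The number of factors grows by one at a time, starting from the assumed pairs, and at each stage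
all subproducts with that many factors are treated. The potential of a set is the sum of the
positions of its vertices in the block-lexicographic order. By `isOptimalOrder_of_improvement` it is
enough to replace every set A that is not an initial segment by a set of the same size, with at
least as many edges and smaller potential.

If A violates the order at two vertices that share a coordinate, its slices in that direction are
replaced by initial segments of the order on one factor fewer. Otherwise A is called compressed; let
x be the first vertex outside A and y the last vertex in A. If x and y lie in one block, then A
consists of all earlier blocks and a subset of this block. All vertices of a block have equally many
neighbours in earlier blocks, so the optimality of the domination order settles this case.

If the blocks differ, no vertex in a block strictly between them shares coordinates with both x and
y. This makes the part numbers of x and y consecutive at the first coordinate j where they differ.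
Strictly between j and the last coordinate, x must lie in the last part and y in the first part. Fix
a coordinate plane that contains j and the last coordinate. Outside the plane the two blocks have
factors with equal δ-sequences, by regularity, hence they have the same shape.

A compressed set meets every plane parallel to the fixed one in an initial segment, so A is encoded
by an antitone function n of the remaining ranks. The surplus of n over a threshold h above the
block of y is moved into the deficit under h above the block of x, by one translation that is as
short as possible; minimality keeps n antitone (`exists_antitone_exchange`). Edges of such sets are
counted by back degrees (`numInduced_boxPi`). The contribution of the coordinates outside the plane
does not drop because the δ-sequences of the parts are non-decreasing
(`IsIsoperimetric.backDegree_le`); the contribution of the plane does not drop because its order is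
optimal (`sum_initSeg_exchange`). -/

namespace EdgeIso

universe u

open Finset
open scoped Classical

/-! ### Counting induced edges -/

section Induced

theorem numInduced_empty {α : Type u} (G : SimpleGraph α) : numInduced G ∅ = 0 := by
  simp [numInduced, edgesBetween]

variable {α : Type u} [Fintype α] (G : SimpleGraph α)

theorem numInduced_insert [DecidableEq α] {S : Finset α} {v : α} (hv : v ∉ S) :
    numInduced G (insert v S : Finset α) = numInduced G S + #{u ∈ S | G.Adj u v} := by
  have h : edgesBetween G (insert v S : Finset α) (insert v S : Finset α) =
      edgesBetween G S S ∪ (fun u => s(u, v)) '' ({u ∈ S | G.Adj u v} : Finset α) := by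
    ext e
    constructor
    · rintro ⟨he, a, ha, b, hb, rfl⟩
      rw [SimpleGraph.mem_edgeSet] at he
      simp only [coe_insert, Set.mem_insert_iff, mem_coe] at ha hb
      rcases ha with rfl | ha <;> rcases hb with rfl | hb
      · exact absurd he (G.loopless.irrefl _)
      · exact Or.inr ⟨b, by simpa using ⟨hb, he.symm⟩, Sym2.eq_swap⟩
      · exact Or.inr ⟨a, by simpa using ⟨ha, he⟩, rfl⟩
      · exact Or.inl ⟨he, a, ha, b, hb, rfl⟩
    · rintro (⟨he, a, ha, b, hb, rfl⟩ | ⟨a, ha, rfl⟩)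
      · exact ⟨he, a, by simp [mem_coe.1 ha], b, by simp [mem_coe.1 hb], rfl⟩
      · simp only [coe_filter, Set.mem_ofPred_eq] at ha
        exact ⟨ha.2, a, by simp [ha.1], v, by simp, rfl⟩
  rw [numInduced, h, Set.ncard_union_eq, Set.ncard_image_of_injective, Set.ncard_coe_finset,
    numInduced]
  · exact fun a b hab => Sym2.congr_left.1 hab
  · rw [Set.disjoint_left]
    rintro _ ⟨_, a, ha, b, hb, rfl⟩ ⟨c, _, hc⟩
    have : v ∈ s(a, b) := hc ▸ Sym2.mem_mk_right c v
    rcases Sym2.mem_iff.1 this with rfl | rfl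
    · exact hv ha
    · exact hv hb

theorem two_mul_numInduced (S : Finset α) :
    2 * numInduced G S = ∑ z ∈ S, #{u ∈ S | G.Adj u z} := by
  induction S using Finset.induction_on with
  | empty => simp [numInduced_empty]
  | insert v S hv ih =>
    rw [numInduced_insert G hv, mul_add, ih, sum_insert hv, filter_insert,
      if_neg (G.loopless.irrefl v)]
    have : ∀ z ∈ S, #{u ∈ insert v S | G.Adj u z} =
        #{u ∈ S | G.Adj u z} + if G.Adj z v then 1 else 0 := by
      intro z _
      rw [filter_insert]
      by_cases h : G.Adj v z
      · rw [if_pos h, if_pos h.symm, card_insert_of_notMem (by simp [hv])]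
      · rw [if_neg h, if_neg fun h' => h h'.symm, add_zero]
    rw [sum_congr rfl this, sum_add_distrib, ← card_filter]
    ring

/-- Counting every induced edge at its upper end. -/
theorem numInduced_eq_sum {φ : α → ℕ} (hφ : Function.Injective φ) (S : Finset α) :
    numInduced G S = ∑ z ∈ S, #{u ∈ S | G.Adj u z ∧ φ u < φ z} := by
  induction S using Finset.induction_on_max_value φ with
  | empty => simp [numInduced_empty]
  | insert v S hv hmax ih =>
    have hlt : ∀ u ∈ S, φ u < φ v := fun u hu =>
      lt_of_le_of_ne (hmax u hu) fun h => hv (hφ h ▸ hu)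
    rw [numInduced_insert G hv, ih, sum_insert hv, add_comm]
    congr 1
    · rw [filter_insert, if_neg (by simp)]
      congr 1
      ext u
      simp only [mem_filter]
      exact ⟨fun h => ⟨h.1, h.2, hlt u h.1⟩, fun h => ⟨h.1, h.2.1⟩⟩
    · refine sum_congr rfl fun z hz => ?_
      rw [filter_insert, if_neg fun h => absurd h.2 (hlt z hz).le.not_gt]

/-- Used with U the union of the earlier blocks and S inside one block: the count then depends on S
only through its size and its own edges. -/
theorem numInduced_union [DecidableEq α] {U S : Finset α} (hd : Disjoint U S) {κ : ℕ}
    (hκ : ∀ z ∈ S, #{u ∈ U | G.Adj u z} = κ) :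
    numInduced G (U ∪ S : Finset α) = numInduced G U + numInduced G S + #S * κ := by
  induction S using Finset.induction_on with
  | empty => simp [numInduced_empty]
  | insert v S hv ih =>
    rw [disjoint_insert_right] at hd
    have h := ih hd.2 fun z hz => hκ z (mem_insert_of_mem hz)
    rw [union_insert, numInduced_insert G (by simp [hd.1, hv]), numInduced_insert G hv, h,
      filter_union, card_union_of_disjoint (disjoint_filter_filter hd.2),
      hκ v (mem_insert_self _ _), card_insert_of_notMem hv]
    ring

theorem numInduced_le_maxInduced (S : Finset α) : numInduced G S ≤ maxInduced G #S :=
  le_sup (f := fun S : Finset α => numInduced G (S : Set α))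
    (mem_powersetCard.2 ⟨subset_univ S, rfl⟩)

end Induced

/-! ### Initial segments of a total order -/

section Initial

variable {α : Type u} [Fintype α] (r : α → α → Prop)

/-- The number of vertices that precede `z`. -/
noncomputable def position (z : α) : ℕ := #{u | r u z}

/-- The set of the first `m` vertices. -/
noncomputable def initSeg (m : ℕ) : Finset α := {z | position r z < m}

variable {r}

theorem mem_initSeg {m : ℕ} {z : α} : z ∈ initSeg r m ↔ position r z < m := by
  simp [initSeg]

variable [IsStrictTotalOrder α r]

theorem position_lt {a b : α} (h : r a b) : position r a < position r b := by
  refine card_lt_card ⟨fun u hu => ?_, fun hs => ?_⟩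
  · simp only [mem_filter, mem_univ, true_and] at hu ⊢
    exact _root_.trans hu h
  · have : a ∈ ({u | r u a} : Finset α) := hs (by simpa using h)
    exact irrefl_of r a (by simpa using this)

theorem position_lt_iff {a b : α} : position r a < position r b ↔ r a b := by
  refine ⟨fun h => ?_, position_lt⟩
  rcases trichotomous_of r a b with h' | rfl | h'
  · exact h'
  · exact absurd h (lt_irrefl _)
  · exact absurd (position_lt h') h.not_gt

theorem position_injective : Function.Injective (position r) := by
  intro a b h
  rcases trichotomous_of r a b with h' | h' | h'
  · exact absurd h (position_lt h').ne
  · exact h'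
  · exact absurd h (position_lt h').ne'

theorem position_lt_card (a : α) : position r a < Fintype.card α :=
  card_lt_univ_of_notMem (x := a) (by simp [irrefl_of r a])

theorem card_initSeg {m : ℕ} (hm : m ≤ Fintype.card α) : #(initSeg r m) = m := by
  have h : (univ : Finset α).image (position r) = range (Fintype.card α) := by
    refine eq_of_subset_of_card_le (fun i hi => ?_) ?_
    · obtain ⟨a, -, rfl⟩ := mem_image.1 hi
      exact mem_range.2 (position_lt_card a)
    · rw [card_range, card_image_of_injective _ position_injective, card_univ]
  have h' : (initSeg r m).image (position r) = range m := by
    ext i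
    simp only [mem_image, mem_initSeg, mem_range]
    constructor
    · rintro ⟨a, ha, rfl⟩
      exact ha
    · intro hi
      obtain ⟨a, -, rfl⟩ := mem_image.1 (h ▸ mem_range.2 (hi.trans_le hm))
      exact ⟨a, hi, rfl⟩
  rw [← card_image_of_injective _ (position_injective (r := r)), h', card_range]

theorem position_lt_card_of_mem {A : Finset α} (hA : ∀ a b, r a b → b ∈ A → a ∈ A) {a : α}
    (ha : a ∈ A) : position r a < #A := by
  refine card_lt_card ⟨fun u hu => hA u a (by simpa using hu) ha, fun hs => ?_⟩
  exact irrefl_of r a (by simpa using hs ha)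

theorem eq_initSeg {A : Finset α} (hA : ∀ a b, r a b → b ∈ A → a ∈ A) : A = initSeg r #A :=
  eq_of_subset_of_card_le (fun _ ha => mem_initSeg.2 (position_lt_card_of_mem hA ha))
    (card_initSeg (card_le_univ A)).le

theorem initSeg_lower {m : ℕ} (a b : α) (h : r a b) (hb : b ∈ initSeg r m) : a ∈ initSeg r m :=
  mem_initSeg.2 ((position_lt h).trans (mem_initSeg.1 hb))

end Initial

/-! ### Optimal orders and the δ-sequence -/

section Optimal

variable {α : Type u} [Fintype α] {r : α → α → Prop}

theorem IsOptimalOrder.numInduced_le {G : SimpleGraph α} (h : IsOptimalOrder G r) (S : Finset α) :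
    numInduced G S ≤ numInduced G (initSeg r #S) := by
  have := h.strictTotal
  have h' := h.optimal _ (initSeg_lower (r := r) (m := #S))
  rw [IsOptimal, card_initSeg (card_le_univ S)] at h'
  exact h' ▸ numInduced_le_maxInduced G S

/-- The number of earlier neighbours of a vertex is a member of the `δ`-sequence. -/
theorem IsOptimalOrder.card_filter_adj {G : SimpleGraph α} (h : IsOptimalOrder G r) (v : α) :
    (#{u | G.Adj u v ∧ r u v} : ℤ) = delta G (position r v + 1) := by
  have := h.strictTotal
  have h₁ := h.optimal _ (initSeg_lower (r := r) (m := position r v))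
  have h₂ := h.optimal _ (initSeg_lower (r := r) (m := position r v + 1))
  have hv := position_lt_card (r := r) v
  rw [IsOptimal, card_initSeg hv.le] at h₁
  rw [IsOptimal, card_initSeg hv] at h₂
  have hins : initSeg r (position r v + 1) = insert v (initSeg r (position r v)) := by
    ext u
    rw [mem_insert, mem_initSeg, mem_initSeg, Nat.lt_succ_iff_lt_or_eq, or_comm]
    exact or_congr_left ⟨fun h => position_injective h, fun h => h ▸ rfl⟩
  rw [hins, numInduced_insert G (by simp [mem_initSeg]), h₁] at h₂
  rw [delta, ← h₂, Nat.add_sub_cancel]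
  have : #{u ∈ initSeg r (position r v) | G.Adj u v} = #{u | G.Adj u v ∧ r u v} := by
    congr 1
    ext u
    simp [mem_initSeg, position_lt_iff, and_comm]
  rw [this]
  push_cast
  ring

end Optimal

/-! ### Decrease of the potential -/

section Sums

variable {α : Type u} {A A' : Finset α} {φ : α → ℕ}

/-- The two differences are equally large, and the largest value on `A' \ A` lies below every value
on `A \ A'`. Each improvement is shown to lower the sum of positions by this criterion. -/
theorem sum_lt_of_exchange (hc : #A' = #A) (hne : A' ≠ A)
    (h : ∀ a' ∈ A', a' ∉ A → ∀ a ∈ A, a ∉ A' → φ a' < φ a) : ∑ z ∈ A', φ z < ∑ z ∈ A, φ z := by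
  have hcard : #(A' \ A) = #(A \ A') := card_sdiff_comm hc
  have hnon : (A' \ A).Nonempty := by
    rw [nonempty_iff_ne_empty]
    intro h0
    exact hne (eq_of_subset_of_card_le (sdiff_eq_empty_iff_subset.1 h0) hc.ge)
  obtain ⟨b, hb, hmax⟩ := exists_max_image (A' \ A) φ hnon
  rw [mem_sdiff] at hb
  have h₁ : ∑ z ∈ A' \ A, φ z ≤ #(A' \ A) * φ b := by
    simpa using sum_le_card_nsmul _ _ _ hmax
  have h₂ : #(A \ A') * (φ b + 1) ≤ ∑ z ∈ A \ A', φ z := by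
    simpa using card_nsmul_le_sum (A \ A') φ (φ b + 1) fun a ha =>
      h b hb.1 hb.2 a (mem_sdiff.1 ha).1 (mem_sdiff.1 ha).2
  have h₃ := card_pos.2 hnon
  have h₄ := sum_inter_add_sum_sdiff A' A φ
  have h₅ := sum_inter_add_sum_sdiff A A' φ
  rw [inter_comm] at h₅
  rw [← hcard] at h₂
  nlinarith

theorem sum_le_of_exchange (hc : #A' = #A)
    (h : ∀ a' ∈ A', a' ∉ A → ∀ a ∈ A, a ∉ A' → φ a' < φ a) : ∑ z ∈ A', φ z ≤ ∑ z ∈ A, φ z := by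
  by_cases hne : A' = A
  · rw [hne]
  · exact (sum_lt_of_exchange hc hne h).le

end Sums

/-! ### Moving a surplus by a shortest translation -/

section Exchange

/-- Sums over a finite set that is changed along a partial injection `ν ↦ ν + c`. -/
theorem sum_le_sum_of_pairs {α : Type*} {S D : Finset α} {σ : α → α} (hσ : Function.Injective σ)
    (hD : D ⊆ S) (hDσ : ∀ ν ∈ D, σ ν ∈ S) (hdis : ∀ ν ∈ D, ∀ μ ∈ D, σ ν ≠ μ) {F F' : α → ℕ}
    (hpair : ∀ ν ∈ D, F ν + F (σ ν) ≤ F' ν + F' (σ ν))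
    (hrest : ∀ l ∈ S, l ∉ D → (∀ ν ∈ D, σ ν ≠ l) → F l = F' l) :
    ∑ l ∈ S, F l ≤ ∑ l ∈ S, F' l := by
  have hsub : D ∪ D.image σ ⊆ S := by
    refine union_subset hD fun l hl => ?_
    obtain ⟨ν, hν, rfl⟩ := mem_image.1 hl
    exact hDσ ν hν
  have hdisj : Disjoint D (D.image σ) := by
    rw [disjoint_left]
    intro μ hμ h
    obtain ⟨ν, hν, h⟩ := mem_image.1 h
    exact hdis ν hν μ hμ h
  rw [← sum_sdiff hsub, ← sum_sdiff hsub, sum_union hdisj, sum_union hdisj,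
    sum_image fun a _ b _ h => hσ h, sum_image fun a _ b _ h => hσ h, ← sum_add_distrib,
    ← sum_add_distrib]
  refine add_le_add (sum_le_sum fun l hl => ?_) (sum_le_sum hpair)
  rw [mem_sdiff, mem_union, mem_image] at hl
  push Not at hl
  exact (hrest l hl.1 hl.2.1 hl.2.2).le

/-- Translating the surplus over the box at `y₀` into the deficit over the box at `x₀`. -/
theorem exists_antitone_exchange {ι : Type*} [Fintype ι] (S : Finset (ι → ℕ)) (n : (ι → ℕ) → ℕ) (hn : Antitone n)
    (x₀ y₀ l : ι → ℕ) (hxy : y₀ ≤ x₀) (h : ℕ) (W : ℕ → ℕ) (w : (ι → ℕ) → ℕ)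
    (hYS : ∀ ν, y₀ ≤ ν → (∀ i, ν i < y₀ i + l i) → ν ∈ S)
    (hXS : ∀ μ, x₀ ≤ μ → (∀ i, μ i < x₀ i + l i) → μ ∈ S)
    (hY : ∀ ν, y₀ ≤ ν → h < n ν → ∀ i, ν i < y₀ i + l i)
    (hX : ∀ μ, (∀ i, μ i < x₀ i + l i) → n μ < h → x₀ ≤ μ)
    (hexY : ∃ ν, y₀ ≤ ν ∧ h < n ν) (hexX : ∃ μ, (∀ i, μ i < x₀ i + l i) ∧ n μ < h)
    (hW : ∀ ν μ, y₀ ≤ ν → (∀ i, ν i < y₀ i + l i) → x₀ ≤ μ → (∀ i, μ i < x₀ i + l i) →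
      h < n ν → n μ < h → W (n ν) + W (n μ) ≤ W h + W (n ν + n μ - h))
    (hw : ∀ ν μ, y₀ ≤ ν → (∀ i, ν i < y₀ i + l i) → x₀ ≤ μ → (∀ i, μ i < x₀ i + l i) →
      ν + x₀ ≤ μ + y₀ → w ν ≤ w μ) :
    ∃ n' : (ι → ℕ) → ℕ, Antitone n' ∧ ∑ ν ∈ S, n' ν = ∑ ν ∈ S, n ν ∧
      ∑ ν ∈ S, (W (n ν) + n ν * w ν) ≤ ∑ ν ∈ S, (W (n' ν) + n' ν * w ν) ∧
      (∃ ν ∈ S, n' ν < n ν) ∧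
      (∀ ν, n' ν < n ν → y₀ ≤ ν ∧ (∀ i, ν i < y₀ i + l i) ∧ h ≤ n' ν) ∧
      (∀ μ, n μ < n' μ → x₀ ≤ μ ∧ (∀ i, μ i < x₀ i + l i) ∧ n' μ ≤ h) := by
  -- `Q c ν`: there is a surplus at ν and a deficit at its translate by c. The upper bounds on ν
  -- itself come from `hY`.
  let Q : (ι → ℕ) → (ι → ℕ) → Prop := fun c ν => y₀ ≤ ν ∧ h < n ν ∧
    (∀ i, ν i + c i < x₀ i + l i) ∧ n (ν + c) < h
  have hex : ∃ s, ∃ c, x₀ ≤ y₀ + c ∧ (∃ ν, Q c ν) ∧ ∑ i, c i = s := by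
    obtain ⟨ν, hν, hnν⟩ := hexY
    obtain ⟨μ, hμ, hnμ⟩ := hexX
    have hxμ := hX μ hμ hnμ
    have hμy : y₀ + (μ - y₀) = μ := by
      ext i
      have h1 := Pi.le_def.1 hxy i
      have h2 := Pi.le_def.1 hxμ i
      simp only [Pi.add_apply, Pi.sub_apply]
      omega
    -- As n is antitone, the corner `y₀` has a surplus as soon as any point above it has one, so it
    -- can be translated onto the given deficit μ.
    refine ⟨_, μ - y₀, by rw [hμy]; exact hxμ, ⟨y₀, le_rfl, hnν.trans_le (hn hν), fun i => ?_, ?_⟩,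
      rfl⟩
    · have h1 := congrFun hμy i
      simp only [Pi.add_apply] at h1
      rw [h1]
      exact hμ i
    · rw [hμy]
      exact hnμ
  obtain ⟨c, hc, ⟨ν₁, hν₁⟩, hcs⟩ := Nat.find_spec hex
  have hmin : ∀ c', x₀ ≤ y₀ + c' → (∃ ν, Q c' ν) → ∑ i, c i ≤ ∑ i, c' i := by
    intro c' h1 h2
    rw [hcs]
    exact Nat.find_min' hex ⟨c', h1, h2, rfl⟩
  -- the translation vector cannot be shortened
  have hshort : ∀ i ν, x₀ i < y₀ i + c i → y₀ ≤ ν → h < n (ν + Pi.single i 1) →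
      (∀ j, ν j + c j < x₀ j + l j) → n (ν + c) < h → False := by
    intro i ν hi hν hnν hb hnc
    have h1 := Pi.le_def.1 hc i
    have h2 := Pi.le_def.1 hxy i
    have h3 := Pi.le_def.1 hν i
    simp only [Pi.add_apply] at h1
    have hci : 0 < c i := by omega
    have hsum : (ν + Pi.single i 1) + (c - Pi.single i 1) = ν + c := by
      ext j
      by_cases hj : j = i
      · subst hj
        simp only [Pi.add_apply, Pi.sub_apply, Pi.single_eq_same]
        omega
      · simp [Pi.single_eq_of_ne hj]
    have hle : ∑ j, c j ≤ ∑ j, (c - Pi.single i 1 : ι → ℕ) j := by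
      refine hmin _ (Pi.le_def.2 fun j => ?_) ⟨ν + Pi.single i 1, fun j => ?_, hnν, fun j => ?_, ?_⟩
      · by_cases hj : j = i
        · subst hj
          simp only [Pi.add_apply, Pi.sub_apply, Pi.single_eq_same]
          omega
        · simpa [Pi.single_eq_of_ne hj] using Pi.le_def.1 hc j
      · exact (hν j).trans (Nat.le_add_right _ _)
      · have := congrFun hsum j
        simp only [Pi.add_apply] at this ⊢
        rw [this]
        exact hb j
      · rw [hsum]
        exact hnc
    refine absurd hle (not_le.2 (sum_lt_sum (fun j _ => Nat.sub_le _ _) ⟨i, mem_univ i, ?_⟩))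
    simp only [Pi.sub_apply, Pi.single_eq_same]
    omega
  -- The smaller of surplus and deficit is moved along c, which leaves the values h and `n ν + n (ν
  -- + c) - h`, the larger one at ν. No point is both source and target, because n exceeds h at
  -- sources and is below h at targets.
  let n' : (ι → ℕ) → ℕ := fun ν =>
    if Q c ν then max h (n ν + n (ν + c) - h)
    else if c ≤ ν ∧ Q c (ν - c) then min h (n (ν - c) + n ν - h) else n ν
  have hn'Q : ∀ ν, Q c ν → n' ν = max h (n ν + n (ν + c) - h) := fun ν hν => if_pos hν
  have hn'c : ∀ ν, Q c ν → n' (ν + c) = min h (n ν + n (ν + c) - h) := by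
    intro ν hν
    have h1 : ¬ Q c (ν + c) := fun hq => absurd hq.2.1 hν.2.2.2.not_gt
    have h2 : ν + c - c = ν := by ext i; simp
    simp only [n']
    rw [if_neg h1, h2, if_pos ⟨fun i => Nat.le_add_left _ _, hν⟩]
  have hn'0 : ∀ ν, ¬ Q c ν → (∀ μ, Q c μ → μ + c ≠ ν) → n' ν = n ν := by
    intro ν h1 h2
    simp only [n']
    rw [if_neg h1, if_neg]
    rintro ⟨h3, h4⟩
    exact h2 _ h4 (by ext i; have := Pi.le_def.1 h3 i; simp only [Pi.add_apply, Pi.sub_apply]; omega)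
  have hcases : ∀ ν, Q c ν ∨ (∃ μ, Q c μ ∧ μ + c = ν) ∨
      (¬ Q c ν ∧ ∀ μ, Q c μ → μ + c ≠ ν) := by
    intro ν
    by_cases h1 : Q c ν
    · exact Or.inl h1
    · by_cases h2 : ∃ μ, Q c μ ∧ μ + c = ν
      · exact Or.inr (Or.inl h2)
      · push Not at h2
        exact Or.inr (Or.inr ⟨h1, h2⟩)
  have hup : ∀ ν, n ν ≤ h → n' ν ≤ h := by
    intro ν hν
    rcases hcases ν with h1 | ⟨μ, h1, rfl⟩ | ⟨h1, h2⟩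
    · exact absurd h1.2.1 hν.not_gt
    · rw [hn'c μ h1]; exact min_le_left _ _
    · rw [hn'0 ν h1 h2]; exact hν
  have hlow : ∀ ν, h ≤ n ν → h ≤ n' ν := by
    intro ν hν
    rcases hcases ν with h1 | ⟨μ, h1, rfl⟩ | ⟨h1, h2⟩
    · rw [hn'Q ν h1]; exact le_max_left _ _
    · exact absurd h1.2.2.2 hν.not_gt
    · rw [hn'0 ν h1 h2]; exact hν
  have hbox : ∀ ν, Q c ν → x₀ ≤ ν + c := fun ν hν => Pi.le_def.2 fun i => by
    have h1 := Pi.le_def.1 hν.1 i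
    have h2 := Pi.le_def.1 hc i
    simp only [Pi.add_apply] at h2 ⊢
    omega
  have hQY : ∀ ν, Q c ν → ∀ i, ν i < y₀ i + l i := fun ν hν => hY ν hν.1 hν.2.1
  have hanti : Antitone n' := by
    intro ν ν' hle
    have hnn := hn hle
    by_cases hν : Q c ν
    · by_cases hν' : n ν' ≤ h
      · exact (hup _ hν').trans (hlow _ hν.2.1.le)
      · push Not at hν'
        have hY' : y₀ ≤ ν' := hν.1.trans hle
        -- If ν' + c left the box in direction i, then `ν i < ν' i` and `x₀ i < y₀ i + c i`. So ν
        -- plus the i-th unit vector still has a surplus, and c minus that vector carries it to the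
        -- same target, contradicting minimality.
        have hb : ∀ i, ν' i + c i < x₀ i + l i := by
          intro i
          by_contra hcon
          have h1 := hY ν' hY' hν' i
          have h2 := hν.2.2.1 i
          have h3 := Pi.le_def.1 hle i
          refine hshort i ν (by omega) hν.1 (hν'.trans_le (hn (Pi.le_def.2 fun j => ?_))) hν.2.2.1 hν.2.2.2
          by_cases hj : j = i
          · subst hj
            simp only [Pi.add_apply, Pi.single_eq_same]
            omega
          · simpa [Pi.single_eq_of_ne hj] using Pi.le_def.1 hle j
        have hnc : n (ν' + c) ≤ n (ν + c) := hn (add_le_add_left hle c)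
        have hQ' : Q c ν' := ⟨hY', hν', hb, hnc.trans_lt hν.2.2.2⟩
        rw [hn'Q _ hν, hn'Q _ hQ']
        omega
    · by_cases hg : ∃ μ, Q c μ ∧ μ + c = ν'
      · obtain ⟨μ, hμ, rfl⟩ := hg
        by_cases hνh : h ≤ n ν
        · exact (hup _ hμ.2.2.2.le).trans (hlow _ hνh)
        · push Not at hνh
          have hνb : ∀ i, ν i < x₀ i + l i := fun i => (hle i).trans_lt (hμ.2.2.1 i)
          have hνx := hX ν hνb hνh
          -- Otherwise c minus the i-th unit vector sends μ to a point still above ν, which has a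
          -- deficit because n is antitone; again c would not be shortest. Hence ν is itself a
          -- translate of a source.
          have hyc : ∀ i, y₀ i + c i ≤ ν i := by
            intro i
            by_contra hcon
            have h1 := Pi.le_def.1 hνx i
            have h2 := Pi.le_def.1 hμ.1 i
            have h3 := Pi.le_def.1 hle i
            have h4 := Pi.le_def.1 hc i
            have h5 := Pi.le_def.1 hxy i
            simp only [Pi.add_apply] at h3 h4
            have hci : 0 < c i := by omega
            have hle' : ∑ j, c j ≤ ∑ j, (c - Pi.single i 1 : ι → ℕ) j := by
              refine hmin _ (Pi.le_def.2 fun j => ?_) ⟨μ, hμ.1, hμ.2.1, fun j => ?_,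
                lt_of_le_of_lt (hn (Pi.le_def.2 fun j => ?_)) hνh⟩
              · by_cases hj : j = i
                · subst hj
                  simp only [Pi.add_apply, Pi.sub_apply, Pi.single_eq_same]
                  omega
                · simpa [Pi.single_eq_of_ne hj] using Pi.le_def.1 hc j
              · have := hμ.2.2.1 j
                simp only [Pi.sub_apply]
                omega
              · by_cases hj : j = i
                · subst hj
                  simp only [Pi.add_apply, Pi.sub_apply, Pi.single_eq_same]
                  omega
                · simpa [Pi.single_eq_of_ne hj] using Pi.le_def.1 hle j
            refine absurd hle' (not_le.2 (sum_lt_sum (fun j _ => Nat.sub_le _ _)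
              ⟨i, mem_univ i, ?_⟩))
            simp only [Pi.sub_apply, Pi.single_eq_same]
            omega
          obtain ⟨ν₀, rfl⟩ : ∃ ν₀, ν₀ + c = ν := ⟨ν - c, by
            ext i; have := hyc i; simp only [Pi.add_apply, Pi.sub_apply]; omega⟩
          have hle₀ : ν₀ ≤ μ := fun i => by simpa using Pi.le_def.1 hle i
          have hn₀ : n μ ≤ n ν₀ := hn hle₀
          have hQ₀ : Q c ν₀ := ⟨fun i => by simpa using hyc i, hμ.2.1.trans_le hn₀, hνb, hνh⟩
          rw [hn'c _ hQ₀, hn'c _ hμ]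
          omega
      -- Here ν is not a source and ν' is not a target, so the move can only raise n at ν and only
      -- lower it at ν'.
      · push Not at hg
        have h1 : n' ν' ≤ n ν' := by
          rcases hcases ν' with h1 | ⟨μ, h1, h2⟩ | ⟨h1, h2⟩
          · rw [hn'Q _ h1]
            have := h1.2.1
            have := h1.2.2.2
            omega
          · exact absurd h2 (hg μ h1)
          · exact (hn'0 _ h1 h2).le
        have h2 : n ν ≤ n' ν := by
          rcases hcases ν with h1 | ⟨μ, h1, rfl⟩ | ⟨h1, h2⟩
          · exact absurd h1 hν
          · rw [hn'c _ h1]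
            have := h1.2.1
            have := h1.2.2.2
            omega
          · exact (hn'0 _ h1 h2).ge
        exact h1.trans (hnn.trans h2)
  let D : Finset (ι → ℕ) := {ν ∈ S | Q c ν}
  have hD : ∀ ν, ν ∈ D ↔ Q c ν := fun ν =>
    ⟨fun hν => (mem_filter.1 hν).2, fun hν => mem_filter.2 ⟨hYS ν hν.1 (hQY ν hν), hν⟩⟩
  have hDσ : ∀ ν ∈ D, ν + c ∈ S := fun ν hν => by
    rw [hD] at hν
    exact hXS _ (hbox ν hν) hν.2.2.1
  have hdis : ∀ ν ∈ D, ∀ μ ∈ D, ν + c ≠ μ := by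
    rintro ν hν _ hμ rfl
    rw [hD] at hν hμ
    exact absurd hμ.2.1 hν.2.2.2.not_gt
  have hrest : ∀ ν ∈ S, ν ∉ D → (∀ μ ∈ D, μ + c ≠ ν) → n' ν = n ν := by
    intro ν _ h1 h2
    rw [hD] at h1
    exact hn'0 ν h1 fun μ hμ => h2 μ ((hD μ).2 hμ)
  have hinj : Function.Injective fun ν : ι → ℕ => ν + c := add_left_injective c
  refine ⟨n', hanti, le_antisymm ?_ ?_, ?_, ⟨ν₁, ?_, ?_⟩, ?_, ?_⟩
  · refine sum_le_sum_of_pairs hinj (filter_subset _ S) hDσ hdis (fun ν hν => ?_) hrest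
    rw [hD] at hν
    have := hν.2.1
    have := hν.2.2.2
    simp only [hn'Q ν hν, hn'c ν hν]
    omega
  · refine sum_le_sum_of_pairs hinj (filter_subset _ S) hDσ hdis (fun ν hν => ?_)
      fun ν h1 h2 h3 => (hrest ν h1 h2 h3).symm
    rw [hD] at hν
    have := hν.2.1
    have := hν.2.2.2
    simp only [hn'Q ν hν, hn'c ν hν]
    omega
  · refine sum_le_sum_of_pairs hinj (filter_subset _ S) hDσ hdis (fun ν hν => ?_)
      fun ν h1 h2 h3 => by rw [hrest ν h1 h2 h3]
    rw [hD] at hν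
    have h1 := hν.2.1
    have h2 := hν.2.2.2
    have h3 := hW ν (ν + c) hν.1 (hQY ν hν) (hbox ν hν) hν.2.2.1 h1 h2
    have h4 := hw ν (ν + c) hν.1 (hQY ν hν) (hbox ν hν) hν.2.2.1 <| Pi.le_def.2 fun i => by
      have := Pi.le_def.1 hc i
      simp only [Pi.add_apply] at this ⊢
      omega
    simp only [hn'Q ν hν, hn'c ν hν]
    generalize n ν = a at *
    generalize n (ν + c) = b at *
    -- Either the deficit is filled and `h - b` units move, or the surplus is exhausted and `a - h`
    -- units move. In both cases the moved units pass from weight `w ν` to the weight `w (ν + c)`,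
    -- which is at least as large.
    rcases le_total h (a + b - h) with hab | hab
    · rw [max_eq_right hab, min_eq_left hab]
      obtain ⟨s, rfl⟩ := Nat.exists_eq_add_of_lt h2
      obtain ⟨a', rfl⟩ : ∃ a', a = a' + (s + 1) := ⟨a - (s + 1), by omega⟩
      have : a' + (s + 1) + b - (b + s + 1) = a' := by omega
      rw [this] at h3 ⊢
      nlinarith
    · rw [max_eq_left hab, min_eq_right hab]
      obtain ⟨s, rfl⟩ := Nat.exists_eq_add_of_lt h1
      have : h + s + 1 + b - h = b + s + 1 := by omega
      rw [this] at h3 ⊢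
      nlinarith
  · exact hYS ν₁ hν₁.1 (hQY ν₁ hν₁)
  · rw [hn'Q ν₁ hν₁]
    have := hν₁.2.1
    have := hν₁.2.2.2
    omega
  · intro ν hν
    rcases hcases ν with h1 | ⟨μ, h1, rfl⟩ | ⟨h1, h2⟩
    · exact ⟨h1.1, hQY ν h1, hlow _ h1.2.1.le⟩
    · rw [hn'c μ h1] at hν
      have := h1.2.1
      have := h1.2.2.2
      omega
    · rw [hn'0 ν h1 h2] at hν
      exact absurd hν (lt_irrefl _)
  · intro ν hν
    rcases hcases ν with h1 | ⟨μ, h1, rfl⟩ | ⟨h1, h2⟩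
    · rw [hn'Q ν h1] at hν
      have := h1.2.1
      have := h1.2.2.2
      omega
    · exact ⟨hbox μ h1, h1.2.2.1, hup _ h1.2.2.2.le⟩
    · rw [hn'0 ν h1 h2] at hν
      exact absurd hν (lt_irrefl _)

end Exchange

/-! ### Edges of down-closed sets as sums of back degrees -/

section BackDegree

/-- The number of neighbours of `v` that precede `v`. -/
noncomputable def backDegree {V : Type u} [Fintype V] (G : SimpleGraph V)
    (η : V ≃ Fin (Fintype.card V)) (v : V) : ℕ :=
  #{u | G.Adj u v ∧ η u < η v}

variable {k : ℕ} {V : Fin k → Type u} [∀ i, Fintype (V i)] (G : ∀ i, SimpleGraph (V i))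
  (η : ∀ i, V i ≃ Fin (Fintype.card (V i)))

/-- The number of edges induced by a set that contains with each vertex all the lower vertices on
the coordinate lines through it. -/
theorem numInduced_boxPi {φ : (∀ i, V i) → ℕ} (hφ : Function.Injective φ)
    (hline : ∀ z i u, η i u < η i (z i) → φ (Function.update z i u) < φ z)
    (A : Finset (∀ i, V i))
    (hA : ∀ z ∈ A, ∀ i u, η i u < η i (z i) → Function.update z i u ∈ A) :
    numInduced (boxPi G) A = ∑ z ∈ A, ∑ i, backDegree (G i) (η i) (z i) := by
  rw [numInduced_eq_sum _ hφ]
  refine sum_congr rfl fun z hz => ?_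
  have h : ({u ∈ A | (boxPi G).Adj u z ∧ φ u < φ z} : Finset (∀ i, V i)) =
      univ.biUnion fun i => ({v | (G i).Adj v (z i) ∧ η i v < η i (z i)} : Finset (V i)).image
        (Function.update z i) := by
    ext u
    simp only [mem_filter, mem_biUnion, mem_image, mem_univ, true_and]
    constructor
    · rintro ⟨hu, ⟨i, hi, hj⟩, hlt⟩
      have hup : Function.update z i (u i) = u := by
        ext j
        by_cases hji : j = i
        · subst hji; simp
        · simp [hji, hj j hji]
      refine ⟨i, u i, ⟨hi, ?_⟩, hup⟩
      rcases lt_trichotomy (η i (u i)) (η i (z i)) with h | h | h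
      · exact h
      · exact absurd ((η i).injective h) hi.ne
      · have h1 := hline u i (z i) h
        have h2 : Function.update u i (z i) = z := by
          rw [← hup]; simp
        rw [h2] at h1
        exact absurd h1 hlt.le.not_gt
    · rintro ⟨i, v, ⟨hv, hlt⟩, rfl⟩
      exact ⟨hA z hz i v hlt, ⟨i, by simpa using hv, fun j hj => by simp [hj]⟩, hline z i v hlt⟩
  rw [h, card_biUnion]
  · refine sum_congr rfl fun i _ => ?_
    rw [card_image_of_injective _ (Function.update_injective z i), backDegree]
  · intro i _ j _ hij
    rw [Function.onFun, disjoint_left]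
    intro u hu hu'
    simp only [mem_image, mem_filter, mem_univ, true_and] at hu hu'
    obtain ⟨v, ⟨-, hv⟩, rfl⟩ := hu
    obtain ⟨w, ⟨-, hw⟩, h⟩ := hu'
    have h1 := congrFun h i
    rw [Function.update_of_ne hij, Function.update_self] at h1
    rw [h1] at hv
    exact lt_irrefl _ hv

end BackDegree

/-! ### Compression in one direction -/

section Compression

theorem boxPi_adj_insertNth {m : ℕ} {V : Fin (m + 1) → Type u} (G : ∀ i, SimpleGraph (V i))
    (i : Fin (m + 1)) {v v' : V i} {q q' : ∀ j, V (i.succAbove j)} :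
    (boxPi G).Adj (i.insertNth (α := V) v' q') (i.insertNth (α := V) v q) ↔
      ((G i).Adj v' v ∧ q' = q) ∨
        (v' = v ∧ (boxPi fun j => G (i.succAbove j)).Adj q' q) := by
  simp only [boxPi]
  rw [Fin.exists_iff_succAbove i]
  simp only [Fin.forall_iff_succAbove i, Fin.insertNth_apply_same, Fin.insertNth_apply_succAbove]
  refine or_congr ?_ ?_
  · refine and_congr_right fun _ => ⟨fun h => ?_, ?_⟩
    · ext j; exact h.2 j (Fin.succAbove_ne i j)
    · rintro rfl; simp
  · constructor
    · rintro ⟨j, h1, h2, h3⟩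
      exact ⟨h2 (Fin.succAbove_ne i j).symm, j, h1, fun l hl => h3 l fun h =>
        hl (Fin.succAbove_right_injective h)⟩
    · rintro ⟨rfl, j, h1, h2⟩
      exact ⟨j, h1, fun _ => rfl, fun l hl => h2 l fun h => hl (h ▸ rfl)⟩

variable {m : ℕ} {V : Fin (m + 1) → Type u} [∀ i, Fintype (V i)] (G : ∀ i, SimpleGraph (V i))
  (i : Fin (m + 1))

/-- The slice of `A` at the value `v` of the coordinate `i`. -/
noncomputable def slice (A : Finset (∀ j, V j)) (v : V i) : Finset (∀ j, V (i.succAbove j)) :=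
  {q | i.insertNth (α := V) v q ∈ A}

variable {i} in
theorem mem_slice {A : Finset (∀ j, V j)} {v : V i} {q : ∀ j, V (i.succAbove j)} :
    q ∈ slice i A v ↔ i.insertNth (α := V) v q ∈ A := by
  simp [slice]

theorem sum_eq_sum_slice (A : Finset (∀ j, V j)) (F : (∀ j, V j) → ℕ) :
    ∑ z ∈ A, F z = ∑ v, ∑ q ∈ slice i A v, F (i.insertNth (α := V) v q) := by
  have h1 : ∑ z ∈ A, F z = ∑ z, if z ∈ A then F z else 0 := by
    rw [← sum_filter, filter_univ_mem]
  rw [h1, ← (Fin.insertNthEquiv V i).sum_comp, Fintype.sum_prod_type]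
  refine sum_congr rfl fun v _ => ?_
  rw [slice, sum_filter]
  rfl

theorem card_adj_insertNth (A : Finset (∀ j, V j)) (v : V i) (q : ∀ j, V (i.succAbove j)) :
    #{u ∈ A | (boxPi G).Adj u (i.insertNth (α := V) v q)} =
      #{q' ∈ slice i A v | (boxPi fun j => G (i.succAbove j)).Adj q' q} +
        #{v' | (G i).Adj v' v ∧ q ∈ slice i A v'} := by
  have h : ({u ∈ A | (boxPi G).Adj u (i.insertNth (α := V) v q)} : Finset (∀ j, V j)) =
      ({q' ∈ slice i A v | (boxPi fun j => G (i.succAbove j)).Adj q' q} : Finset _).image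
        (fun q' => i.insertNth (α := V) v q') ∪
      ({v' | (G i).Adj v' v ∧ q ∈ slice i A v'} : Finset (V i)).image
        (fun v' => i.insertNth (α := V) v' q) := by
    ext u
    obtain ⟨w, p, rfl⟩ : ∃ w p, u = i.insertNth (α := V) w p := ⟨u i, i.removeNth u, by simp⟩
    simp only [mem_filter, mem_union, mem_image, mem_univ, true_and,
      mem_slice, boxPi_adj_insertNth G i]
    constructor
    · rintro ⟨hA, ⟨h1, rfl⟩ | ⟨rfl, h1⟩⟩
      · exact Or.inr ⟨w, ⟨h1, hA⟩, rfl⟩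
      · exact Or.inl ⟨p, ⟨hA, h1⟩, rfl⟩
    · rintro (⟨q', ⟨h1, h2⟩, h3⟩ | ⟨v', ⟨h1, h2⟩, h3⟩)
      · obtain ⟨rfl, rfl⟩ := Fin.insertNth_inj.1 h3
        exact ⟨h1, Or.inr ⟨rfl, h2⟩⟩
      · obtain ⟨rfl, rfl⟩ := Fin.insertNth_inj.1 h3
        exact ⟨h2, Or.inl ⟨h1, rfl⟩⟩
  rw [h, card_union_of_disjoint, card_image_of_injective _ (Fin.insertNth_right_injective _),
    card_image_of_injective _ (Fin.insertNth_left_injective _)]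
  rw [disjoint_left]
  intro u hu hu'
  simp only [mem_image, mem_filter, mem_univ, true_and] at hu hu'
  obtain ⟨q', -, rfl⟩ := hu
  obtain ⟨v', ⟨h1, -⟩, h2⟩ := hu'
  exact h1.ne (Fin.insertNth_inj.1 h2).1

/-- Edges not in direction i lie inside slices; edges in direction i over an adjacent pair v, v'
correspond to the common points of the two slices. -/
theorem two_mul_numInduced_slice (A : Finset (∀ j, V j)) :
    2 * numInduced (boxPi G) A = ∑ v : V i,
      (2 * numInduced (boxPi fun j => G (i.succAbove j)) (slice i A v) +
        ∑ v' with (G i).Adj v' v, #(slice i A v ∩ slice i A v')) := by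
  rw [two_mul_numInduced, sum_eq_sum_slice i]
  refine sum_congr rfl fun v _ => ?_
  rw [two_mul_numInduced, sum_congr rfl fun q _ => card_adj_insertNth G i A v q, sum_add_distrib]
  congr 1
  simp only [card_eq_sum_ones, sum_filter, ← filter_mem_eq_inter]
  rw [sum_comm]
  refine sum_congr rfl fun v' _ => ?_
  split_ifs with h
  · simp [h]
  · simp [h]

variable (r : (∀ j, V (i.succAbove j)) → (∀ j, V (i.succAbove j)) → Prop)

/-- All slices of `A` in the direction `i` are replaced by initial segments. -/
noncomputable def compress (A : Finset (∀ j, V j)) : Finset (∀ j, V j) :=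
  {z | position r (fun j => z (i.succAbove j)) < #(slice i A (z i))}

theorem slice_compress (A : Finset (∀ j, V j)) (v : V i) :
    slice i (compress i r A) v = initSeg r #(slice i A v) := by
  ext q
  simp [mem_slice, compress, mem_initSeg]

variable {r} {G}

theorem card_compress (h : IsStrictTotalOrder _ r) (A : Finset (∀ j, V j)) :
    #(compress i r A) = #A := by
  rw [card_eq_sum_ones, card_eq_sum_ones, sum_eq_sum_slice i, sum_eq_sum_slice i A]
  refine sum_congr rfl fun v _ => ?_
  rw [slice_compress, ← card_eq_sum_ones, ← card_eq_sum_ones, card_initSeg (card_le_univ _)]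

/-- Initial segments maximise the edges within slices. They are also nested, so two of them overlap
in the smaller of their sizes, the largest overlap possible. -/
theorem numInduced_le_compress (h : IsOptimalOrder (boxPi fun j => G (i.succAbove j)) r)
    (A : Finset (∀ j, V j)) :
    numInduced (boxPi G) A ≤ numInduced (boxPi G) (compress i r A) := by
  have := h.strictTotal
  refine le_of_mul_le_mul_left ?_ (zero_lt_two' ℕ)
  rw [two_mul_numInduced_slice G i, two_mul_numInduced_slice G i]
  refine sum_le_sum fun v _ => add_le_add ?_ (sum_le_sum fun v' _ => ?_)
  · rw [slice_compress]
    exact Nat.mul_le_mul_left 2 (h.numInduced_le _)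
  · rw [slice_compress, slice_compress]
    have h1 : ∀ a b : ℕ, initSeg r a ∩ initSeg r b = initSeg r (min a b) := by
      intro a b
      ext q
      simp [mem_initSeg]
    rw [h1, card_initSeg ((min_le_left _ _).trans (card_le_univ _))]
    exact le_min (card_le_card inter_subset_left) (card_le_card inter_subset_right)

/-- Compression moves vertices down, unless the set is compressed. -/
theorem sum_compress_lt (h : IsStrictTotalOrder _ r) (A : Finset (∀ j, V j))
    {φ : (∀ j, V j) → ℕ}
    (hφ : ∀ v q q', r q q' → φ (i.insertNth (α := V) v q) < φ (i.insertNth (α := V) v q'))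
    (hne : ∃ v q q', r q q' ∧ i.insertNth (α := V) v q' ∈ A ∧ i.insertNth (α := V) v q ∉ A) :
    ∑ z ∈ compress i r A, φ z < ∑ z ∈ A, φ z := by
  obtain ⟨v, q, q', hqq, hq', hq⟩ := hne
  rw [sum_eq_sum_slice i, sum_eq_sum_slice i A]
  have hc : ∀ v, #(slice i (compress i r A) v) = #(slice i A v) := fun v => by
    rw [slice_compress, card_initSeg (card_le_univ _)]
  have hex : ∀ v, ∀ a' ∈ slice i (compress i r A) v, a' ∉ slice i A v →
      ∀ a ∈ slice i A v, a ∉ slice i (compress i r A) v →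
      φ (i.insertNth (α := V) v a') < φ (i.insertNth (α := V) v a) := by
    intro v a' h1 _ a _ h2
    rw [slice_compress, mem_initSeg] at h1 h2
    exact hφ _ _ _ (position_lt_iff.1 (h1.trans_le (not_lt.1 h2)))
  refine sum_lt_sum (fun v _ => sum_le_of_exchange (hc v) (hex v))
    ⟨v, mem_univ v, sum_lt_of_exchange (hc v) ?_ (hex v)⟩
  intro heq
  rw [slice_compress] at heq
  refine hq (mem_slice.1 (heq ▸ initSeg_lower q q' hqq ?_))
  rw [heq]
  exact mem_slice.2 hq'

end Compression

/-! ### Sets described by their slices in parallel planes -/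

section Plane

variable {k : ℕ} {V : Fin k → Type u} [∀ i, Fintype (V i)]
  (η : ∀ i, V i ≃ Fin (Fintype.card (V i))) (f : Fin 2 ↪o Fin k)

/-- The numbers of the coordinates outside of a coordinate plane. -/
def coRanks (z : ∀ i, V i) : {i // i ∉ Set.range f} → ℕ := fun i => (η i (z i) : ℕ)

variable {η f}

theorem coRanks_lt_card (z : ∀ i, V i) (i : {i // i ∉ Set.range f}) :
    coRanks η f z i < Fintype.card (V i) :=
  (η i (z i)).2

theorem eq_of_coRanks {z z' : ∀ i, V i} (h₁ : coRanks η f z = coRanks η f z')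
    (h₂ : (fun j => z (f j)) = fun j => z' (f j)) : z = z' := by
  ext i
  by_cases hi : i ∈ Set.range f
  · obtain ⟨j, rfl⟩ := hi
    exact congrFun h₂ j
  · exact (η i).injective (Fin.ext (congrFun h₁ ⟨i, hi⟩))

theorem exists_coRanks {ν : {i // i ∉ Set.range f} → ℕ}
    (hν : ∀ i, ν i < Fintype.card (V i)) (q : ∀ j, V (f j)) :
    ∃ z : ∀ i, V i, coRanks η f z = ν ∧ (fun j => z (f j)) = q := by
  have h : ∀ i, ∃ v : V i, (∀ j, ∀ h : f j = i, v = h ▸ q j) ∧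
      ∀ h : i ∉ Set.range f, (η i v : ℕ) = ν ⟨i, h⟩ := by
    intro i
    by_cases hi : i ∈ Set.range f
    · obtain ⟨j, rfl⟩ := hi
      refine ⟨q j, fun j' h => ?_, fun h => absurd ⟨j, rfl⟩ h⟩
      obtain rfl := f.injective h
      rfl
    · exact ⟨(η i).symm ⟨ν ⟨i, hi⟩, hν ⟨i, hi⟩⟩, fun j h => absurd ⟨j, h⟩ hi, fun h => by simp⟩
  choose z hz using h
  exact ⟨z, funext fun i => (hz i).2 i.2, funext fun j => (hz (f j)).1 j rfl⟩

/-- The set whose slices in the planes parallel to the coordinate plane of `f` are initial segments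
with the numbers of vertices given by `n`. -/
noncomputable def planeSet (η : ∀ i, V i ≃ Fin (Fintype.card (V i))) (f : Fin 2 ↪o Fin k)
    (r₂ : (∀ j, V (f j)) → (∀ j, V (f j)) → Prop) (n : ({i // i ∉ Set.range f} → ℕ) → ℕ) :
    Finset (∀ i, V i) :=
  {z | position r₂ (fun j => z (f j)) < n (coRanks η f z)}

variable {r₂ : (∀ j, V (f j)) → (∀ j, V (f j)) → Prop}

theorem mem_planeSet {n : ({i // i ∉ Set.range f} → ℕ) → ℕ} {z : ∀ i, V i} :
    z ∈ planeSet η f r₂ n ↔ position r₂ (fun j => z (f j)) < n (coRanks η f z) := by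
  simp [planeSet]

theorem planeSet_lower [IsStrictTotalOrder _ r₂]
    (hmono₂ : ∀ q q' : ∀ j, V (f j), (∀ j, η (f j) (q j) ≤ η (f j) (q' j)) → q ≠ q' → r₂ q q')
    {n : ({i // i ∉ Set.range f} → ℕ) → ℕ} (hn : Antitone n) {z z' : ∀ i, V i}
    (hz : ∀ i, η i (z i) ≤ η i (z' i)) (h : z' ∈ planeSet η f r₂ n) : z ∈ planeSet η f r₂ n := by
  rw [mem_planeSet] at h ⊢
  have h₁ : n (coRanks η f z') ≤ n (coRanks η f z) := hn fun i => hz i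
  have h₂ : position r₂ (fun j => z (f j)) ≤ position r₂ (fun j => z' (f j)) := by
    by_cases he : (fun j => z (f j)) = fun j => z' (f j)
    · rw [he]
    · exact (position_lt (hmono₂ _ _ (fun j => hz (f j)) he)).le
  omega

theorem sum_planeSet [IsStrictTotalOrder _ r₂] {n : ({i // i ∉ Set.range f} → ℕ) → ℕ}
    (F : (∀ j, V (f j)) → ℕ) (w : ({i // i ∉ Set.range f} → ℕ) → ℕ)
    (hn : ∀ ν, n ν ≤ Fintype.card (∀ j, V (f j))) :
    ∑ z ∈ planeSet η f r₂ n, (F (fun j => z (f j)) + w (coRanks η f z)) =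
      ∑ ν ∈ Fintype.piFinset fun i : {i // i ∉ Set.range f} => range (Fintype.card (V i)),
        (∑ q ∈ initSeg r₂ (n ν), F q + n ν * w ν) := by
  rw [← sum_fiberwise_of_maps_to (g := coRanks η f) fun z _ =>
    Fintype.mem_piFinset.2 fun i => mem_range.2 (coRanks_lt_card z i)]
  refine sum_congr rfl fun ν hν => ?_
  have hν' : ∀ i, ν i < Fintype.card (V i) := fun i =>
    mem_range.1 (Fintype.mem_piFinset.1 hν i)
  have h : n ν * w ν = ∑ q ∈ initSeg r₂ (n ν), w ν := by
    rw [sum_const, card_initSeg (hn ν), smul_eq_mul]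
  rw [h, ← sum_add_distrib]
  refine sum_nbij (fun z j => z (f j)) ?_ ?_ ?_ ?_
  · intro z hz
    rw [mem_filter, mem_planeSet] at hz
    rw [mem_initSeg, ← hz.2]
    exact hz.1
  · intro z hz z' hz' h
    rw [mem_coe, mem_filter] at hz hz'
    exact eq_of_coRanks (hz.2.trans hz'.2.symm) h
  · intro q hq
    obtain ⟨z, hz, rfl⟩ := exists_coRanks (η := η) hν' q
    refine ⟨z, ?_, rfl⟩
    rw [mem_coe, mem_initSeg] at hq
    rw [mem_coe, mem_filter, mem_planeSet, hz]
    exact ⟨hq, rfl⟩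
  · intro z hz
    rw [mem_filter] at hz
    rw [hz.2]

theorem card_planeSet [IsStrictTotalOrder _ r₂] {n : ({i // i ∉ Set.range f} → ℕ) → ℕ}
    (hn : ∀ ν, n ν ≤ Fintype.card (∀ j, V (f j))) :
    #(planeSet η f r₂ n) =
      ∑ ν ∈ Fintype.piFinset fun i : {i // i ∉ Set.range f} => range (Fintype.card (V i)), n ν := by
  have h := sum_planeSet (η := η) (r₂ := r₂) (fun _ => 0) (fun _ => 1) hn
  simpa using h

/-- A set that is compressed is a `planeSet`. -/
theorem exists_eq_planeSet [IsStrictTotalOrder _ r₂] (hf : ∃ i, i ∉ Set.range f)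
    {r : (∀ i, V i) → (∀ i, V i) → Prop} [IsStrictTotalOrder _ r]
    (hmono : ∀ z z' : ∀ i, V i, (∀ i, η i (z i) ≤ η i (z' i)) → z ≠ z' → r z z')
    (hr₂ : ∀ z z' : ∀ i, V i, (∀ i, i ∉ Set.range f → z i = z' i) → r z z' →
      r₂ (fun j => z (f j)) fun j => z' (f j))
    {A : Finset (∀ i, V i)} (hA : ∀ z z', (∃ i, z i = z' i) → r z z' → z' ∈ A → z ∈ A) :
    ∃ n : ({i // i ∉ Set.range f} → ℕ) → ℕ, Antitone n ∧
      (∀ ν, n ν ≤ Fintype.card (∀ j, V (f j))) ∧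
      (∀ ν, 0 < n ν → ∀ i, ν i < Fintype.card (V i)) ∧ A = planeSet η f r₂ n := by
  let S : ({i // i ∉ Set.range f} → ℕ) → Finset (∀ j, V (f j)) := fun ν =>
    ({z ∈ A | coRanks η f z = ν} : Finset (∀ i, V i)).image fun z j => z (f j)
  have hS : ∀ z, z ∈ A ↔ (fun j => z (f j)) ∈ S (coRanks η f z) := by
    intro z
    simp only [S, mem_image, mem_filter]
    constructor
    · exact fun h => ⟨z, ⟨h, rfl⟩, rfl⟩
    · rintro ⟨z', ⟨h₁, h₂⟩, h₃⟩
      rwa [← eq_of_coRanks h₂ h₃]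
  have hlow : ∀ ν q q', r₂ q q' → q' ∈ S ν → q ∈ S ν := by
    intro ν q q' hq h
    simp only [S, mem_image, mem_filter] at h ⊢
    obtain ⟨z', ⟨h₁, rfl⟩, rfl⟩ := h
    obtain ⟨z, hz, rfl⟩ := exists_coRanks (η := η) (coRanks_lt_card z') q
    have hout : ∀ i, i ∉ Set.range f → z i = z' i := fun i hi =>
      (η i).injective (Fin.ext (congrFun hz ⟨i, hi⟩))
    refine ⟨z, ⟨hA z z' (hf.imp hout) ?_ h₁, hz⟩, rfl⟩
    -- `hr₂` only passes from the product to the plane; totality of r gives the converse.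
    rcases trichotomous_of r z z' with h | rfl | h
    · exact h
    · exact absurd hq (irrefl_of r₂ _)
    · exact absurd (hr₂ z' z (fun i hi => (hout i hi).symm) h) (asymm_of r₂ hq)
  refine ⟨fun ν => #(S ν), fun ν ν' hle => card_le_card fun q hq => ?_, fun ν => card_le_univ _,
    fun ν hν i => ?_, ?_⟩
  · simp only [S, mem_image, mem_filter] at hq ⊢
    obtain ⟨z', ⟨h₁, rfl⟩, rfl⟩ := hq
    obtain ⟨z, rfl, hz⟩ := exists_coRanks (η := η)
      (fun i => (Pi.le_def.1 hle i).trans_lt (coRanks_lt_card z' i)) fun j => z' (f j)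
    refine ⟨z, ⟨?_, rfl⟩, hz⟩
    by_cases hzz : z = z'
    · rwa [hzz]
    · refine hA z z' ⟨f 0, congrFun hz 0⟩ (hmono z z' (fun i => ?_) hzz) h₁
      by_cases hi : i ∈ Set.range f
      · obtain ⟨j, rfl⟩ := hi
        exact (congrArg _ (congrFun hz j)).le
      · exact Pi.le_def.1 hle ⟨i, hi⟩
  · obtain ⟨q, hq⟩ := card_pos.1 hν
    simp only [S, mem_image, mem_filter] at hq
    obtain ⟨z, ⟨-, rfl⟩, -⟩ := hq
    exact coRanks_lt_card z i
  · ext z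
    rw [hS, mem_planeSet]
    conv_lhs => rw [eq_initSeg (hlow _), mem_initSeg]

end Plane

/-! ### The exchange between parallel planes -/

section PlaneExchange

variable {k : ℕ} {V : Fin k → Type u} [∀ i, Fintype (V i)]
  {η : ∀ i, V i ≃ Fin (Fintype.card (V i))} {f : Fin 2 ↪o Fin k}

/-- In a coordinate plane, a surplus over `h` and a deficit under `h` that have no coordinates in
common are worth less than the initial segments of the order. -/
theorem sum_initSeg_exchange {W : Fin 2 → Type u} [∀ i, Fintype (W i)]
    {θ : ∀ i, W i ≃ Fin (Fintype.card (W i))} {G : ∀ i, SimpleGraph (W i)}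
    {r : (∀ i, W i) → (∀ i, W i) → Prop} (hr : IsOptimalOrder (boxPi G) r)
    (hmono : ∀ q q' : ∀ i, W i, (∀ i, θ i (q i) ≤ θ i (q' i)) → q ≠ q' → r q q') {a b h : ℕ}
    (ha : h < a) (hac : a ≤ Fintype.card (∀ i, W i)) (hb : b < h)
    (hno : ∀ q q', b ≤ position r q → position r q < h → h ≤ position r q' →
      position r q' < a → ∀ i, q i ≠ q' i) :
    ∑ q ∈ initSeg r a, ∑ i, backDegree (G i) (θ i) (q i) +
        ∑ q ∈ initSeg r b, ∑ i, backDegree (G i) (θ i) (q i) ≤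
      ∑ q ∈ initSeg r h, ∑ i, backDegree (G i) (θ i) (q i) +
        ∑ q ∈ initSeg r (a + b - h), ∑ i, backDegree (G i) (θ i) (q i) := by
  have := hr.strictTotal
  have hline : ∀ (z : ∀ i, W i) i u, θ i u < θ i (z i) → r (Function.update z i u) z := by
    intro z i u hu
    refine hmono _ _ (fun j => ?_) fun he => ?_
    · by_cases hj : j = i
      · subst hj; simpa using hu.le
      · simp [hj]
    · rw [← he] at hu; simp at hu
  have hformula := numInduced_boxPi G θ (position_injective (r := r))
    fun z i u hu => position_lt (hline z i u hu)
  have hsub : initSeg r h ⊆ initSeg r a := fun q hq => mem_initSeg.2 ((mem_initSeg.1 hq).trans ha)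
  -- T omits the positions from b up to h. By `hno` a kept vertex beyond h shares no coordinate with
  -- an omitted one, so T is closed downwards along coordinate lines and the back degree formula
  -- applies to it. Comparing T with the initial segment of its size gives the claim.
  let T := initSeg r b ∪ (initSeg r a \ initSeg r h)
  have hdis : Disjoint (initSeg r b) (initSeg r a \ initSeg r h) := by
    rw [disjoint_left]
    intro q hq hq'
    rw [mem_sdiff, mem_initSeg, mem_initSeg] at hq'
    rw [mem_initSeg] at hq
    omega
  have hT : #T = a + b - h := by
    rw [card_union_of_disjoint hdis, card_sdiff_of_subset hsub, card_initSeg (by omega),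
      card_initSeg (by omega), card_initSeg (by omega)]
    omega
  have hTlow : ∀ z ∈ T, ∀ i u, θ i u < θ i (z i) → Function.update z i u ∈ T := by
    intro z hz i u hu
    have h₁ := position_lt (hline z i u hu)
    simp only [T, mem_union, mem_sdiff, mem_initSeg] at hz ⊢
    by_contra hcon
    -- `i + 1` is the other coordinate of the plane, which a change at i leaves fixed.
    have hi : (i + 1 : Fin 2) ≠ i := by fin_cases i <;> simp
    refine hno (Function.update z i u) z (by omega) (by omega) (by omega) (by omega) (i + 1) ?_
    simp [hi]
  have h₁ := hr.numInduced_le T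
  rw [hT, hformula T hTlow, hformula _ fun z hz i u hu => initSeg_lower _ _ (hline z i u hu) hz,
    sum_union hdis] at h₁
  have h₂ := sum_sdiff (f := fun q => ∑ i, backDegree (G i) (θ i) (q i)) hsub
  linarith

/-- `exists_antitone_exchange` in terms of vertices. `H` cuts an initial segment out of the plane,
whose size is the threshold. `hY` and `hX` confine the surplus and the deficit to the boxes at `y₀`
and `x₀`; `hlt` puts every receiving vertex before every giving one, so the potential falls. -/
theorem exists_improvement_of_exchange {G : ∀ i, SimpleGraph (V i)} (hf : ∃ i, i ∉ Set.range f)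
    {r : (∀ i, V i) → (∀ i, V i) → Prop} (hr : IsStrictTotalOrder _ r)
    (hmono : ∀ z z' : ∀ i, V i, (∀ i, η i (z i) ≤ η i (z' i)) → z ≠ z' → r z z')
    {r₂ : (∀ j, V (f j)) → (∀ j, V (f j)) → Prop}
    (h₂ : IsOptimalOrder (boxPi fun j => G (f j)) r₂)
    (hmono₂ : ∀ q q' : ∀ j, V (f j), (∀ j, η (f j) (q j) ≤ η (f j) (q' j)) → q ≠ q' → r₂ q q')
    (hr₂ : ∀ z z' : ∀ i, V i, (∀ i, i ∉ Set.range f → z i = z' i) → r z z' →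
      r₂ (fun j => z (f j)) fun j => z' (f j))
    {H : (∀ j, V (f j)) → Prop} (hH : ∀ q q', r₂ q q' → H q' → H q)
    {x₀ y₀ l : {i // i ∉ Set.range f} → ℕ} (hxy : y₀ ≤ x₀)
    (hbox : ∀ i, x₀ i + l i ≤ Fintype.card (V i))
    {A : Finset (∀ i, V i)} (hA : ∀ z z', (∃ i, z i = z' i) → r z z' → z' ∈ A → z ∈ A)
    (hY : ∀ z ∈ A, y₀ ≤ coRanks η f z → ¬ H (fun j => z (f j)) →
      ∀ i, coRanks η f z i < y₀ i + l i)
    (hX : ∀ z ∉ A, (∀ i, coRanks η f z i < x₀ i + l i) → H (fun j => z (f j)) →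
      x₀ ≤ coRanks η f z)
    (hlt : ∀ z z', x₀ ≤ coRanks η f z → (∀ i, coRanks η f z i < x₀ i + l i) →
      H (fun j => z (f j)) → y₀ ≤ coRanks η f z' → (∀ i, coRanks η f z' i < y₀ i + l i) →
      ¬ H (fun j => z' (f j)) → r z z')
    (hexY : ∃ z ∈ A, y₀ ≤ coRanks η f z ∧ ¬ H (fun j => z (f j)))
    (hexX : ∃ z ∉ A, (∀ i, coRanks η f z i < x₀ i + l i) ∧ H (fun j => z (f j)))
    (hw : ∀ (i : {i // i ∉ Set.range f}) (u v : V i), y₀ i ≤ η i u → (η i u : ℕ) < y₀ i + l i →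
      x₀ i ≤ η i v → (η i v : ℕ) < x₀ i + l i → (η i u : ℕ) + x₀ i ≤ η i v + y₀ i →
      backDegree (G i) (η i) u ≤ backDegree (G i) (η i) v) :
    ∃ A' : Finset (∀ i, V i), #A' = #A ∧ numInduced (boxPi G) A ≤ numInduced (boxPi G) A' ∧
      ∑ z ∈ A', position r z < ∑ z ∈ A, position r z := by
  have := h₂.strictTotal
  obtain ⟨n, hn, hnc, hpos, rfl⟩ := exists_eq_planeSet hf hmono hr₂ hA
  let K : Finset (∀ j, V (f j)) := {q | H q}
  have hK : ∀ q, H q ↔ position r₂ q < #K := by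
    intro q
    have h₁ : K = initSeg r₂ #K := eq_initSeg fun a b hab hb => by
      simp only [K, mem_filter, mem_univ, true_and] at hb ⊢
      exact hH a b hab hb
    rw [← mem_initSeg, ← h₁]
    simp [K]
  have hKc : #K ≤ Fintype.card (∀ j, V (f j)) := card_le_univ K
  simp only [hK, not_lt] at hY hX hlt hexY hexX
  generalize #K = h at *
  have hyc : ∀ i : {i // i ∉ Set.range f}, y₀ i + l i ≤ Fintype.card (V i) := fun i => by
    have h₃ := hbox i
    have h₄ := Pi.le_def.1 hxy i
    omega
  have hq : ∀ m, m < Fintype.card (∀ j, V (f j)) → ∃ q, position r₂ q = m := by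
    intro m hm
    by_contra! hcon
    have h₃ : initSeg r₂ (m + 1) = initSeg r₂ m := by
      ext q
      rw [mem_initSeg, mem_initSeg]
      have := hcon q
      omega
    have h₄ := congrArg card h₃
    rw [card_initSeg hm, card_initSeg hm.le] at h₄
    omega
  -- Back degree as a function of the rank; 0 is a filler for numbers that are not ranks.
  let wt : ∀ i : {i // i ∉ Set.range f}, ℕ → ℕ := fun i a =>
    if ha : a < Fintype.card (V i) then backDegree (G i) (η i) ((η i).symm ⟨a, ha⟩) else 0
  have hwt : ∀ (z : ∀ i, V i) (i : {i // i ∉ Set.range f}),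
      wt i (coRanks η f z i) = backDegree (G i) (η i) (z i) := by
    intro z i
    simp [wt, coRanks]
  obtain ⟨n', hn', hsum, hΦ, ⟨ν₁, hν₁S, hν₁⟩, hdown, hup⟩ := exists_antitone_exchange
    (Fintype.piFinset fun i : {i // i ∉ Set.range f} => range (Fintype.card (V i))) n hn x₀ y₀ l hxy
    h (fun m => ∑ q ∈ initSeg r₂ m, ∑ j, backDegree (G (f j)) (η (f j)) (q j))
    (fun ν => ∑ i, wt i (ν i))
    (fun ν _ h₃ => Fintype.mem_piFinset.2 fun i => mem_range.2 ((h₃ i).trans_le (hyc i)))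
    (fun ν _ h₃ => Fintype.mem_piFinset.2 fun i => mem_range.2 ((h₃ i).trans_le (hbox i)))
    (fun ν h₃ h₄ => by
      obtain ⟨q, hq⟩ := hq h (h₄.trans_le (hnc ν))
      obtain ⟨z, rfl, rfl⟩ := exists_coRanks (η := η) (hpos ν (Nat.zero_lt_of_lt h₄)) q
      exact hY z (mem_planeSet.2 (hq ▸ h₄)) h₃ hq.ge)
    (fun μ h₃ h₄ => by
      obtain ⟨q, hq⟩ := hq (n μ) (h₄.trans_le hKc)
      obtain ⟨z, rfl, rfl⟩ := exists_coRanks (η := η) (fun i => (h₃ i).trans_le (hbox i)) q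
      exact hX z (fun hz => absurd (mem_planeSet.1 hz) hq.not_lt) h₃ (hq ▸ h₄))
    (by
      obtain ⟨z, hz, h₃, h₄⟩ := hexY
      exact ⟨_, h₃, h₄.trans_lt (mem_planeSet.1 hz)⟩)
    (by
      obtain ⟨z, hz, h₃, h₄⟩ := hexX
      rw [mem_planeSet, not_lt] at hz
      exact ⟨_, h₃, hz.trans_lt h₄⟩)
    (fun ν μ hν hν' hμ hμ' hhν hhμ => by
      -- q lifts to a vertex outside A and q' to a later vertex of A. A common coordinate would
      -- contradict that A is compressed.
      refine sum_initSeg_exchange h₂ hmono₂ hhν (hnc ν) hhμ fun q q' h₃ h₄ h₅ h₆ i hi => ?_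
      obtain ⟨z, rfl, rfl⟩ := exists_coRanks (η := η) (fun i => (hμ' i).trans_le (hbox i)) q
      obtain ⟨z', rfl, rfl⟩ := exists_coRanks (η := η) (fun i => (hν' i).trans_le (hyc i)) q'
      refine absurd (hA z z' ⟨f i, hi⟩ (hlt z z' hμ hμ' h₄ hν hν' h₅) (mem_planeSet.2 h₆)) ?_
      rw [mem_planeSet]
      exact h₃.not_gt)
    (fun ν μ hν hν' hμ hμ' hle => by
      refine sum_le_sum fun i _ => ?_
      have h₃ := (hν' i).trans_le (hyc i)
      have h₄ := (hμ' i).trans_le (hbox i)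
      simp only [wt]
      rw [dif_pos h₃, dif_pos h₄]
      refine hw i _ _ ?_ ?_ ?_ ?_ ?_ <;> simp only [Equiv.apply_symm_apply]
      · exact Pi.le_def.1 hν i
      · exact hν' i
      · exact Pi.le_def.1 hμ i
      · exact hμ' i
      · exact Pi.le_def.1 hle i)
  have hn'c : ∀ ν, n' ν ≤ Fintype.card (∀ j, V (f j)) := by
    intro ν
    by_cases h₃ : n ν < n' ν
    · exact (hup ν h₃).2.2.trans hKc
    · exact (not_lt.1 h₃).trans (hnc ν)
  have hline : ∀ (z : ∀ i, V i) i u, η i u < η i (z i) →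
      (∀ j, η j (Function.update z i u j) ≤ η j (z j)) ∧ Function.update z i u ≠ z := by
    intro z i u hu
    refine ⟨fun j => ?_, fun he => ?_⟩
    · by_cases hj : j = i
      · subst hj; simpa using hu.le
      · simp [hj]
    · rw [← he] at hu; simp at hu
  have hformula : ∀ n : ({i // i ∉ Set.range f} → ℕ) → ℕ, Antitone n →
      (∀ ν, n ν ≤ Fintype.card (∀ j, V (f j))) →
      numInduced (boxPi G) (planeSet η f r₂ n) =
        ∑ ν ∈ Fintype.piFinset fun i : {i // i ∉ Set.range f} => range (Fintype.card (V i)),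
          (∑ q ∈ initSeg r₂ (n ν), ∑ j, backDegree (G (f j)) (η (f j)) (q j) +
            n ν * ∑ i, wt i (ν i)) := by
    intro n hn hnc
    rw [numInduced_boxPi G η (position_injective (r := r))
      (fun z i u hu => position_lt (hmono _ _ (hline z i u hu).1 (hline z i u hu).2)) _
      fun z hz i u hu => planeSet_lower hmono₂ hn (hline z i u hu).1 hz]
    rw [← sum_planeSet (η := η) _ (fun ν => ∑ i, wt i (ν i)) hnc]
    refine sum_congr rfl fun z _ => ?_
    simp only [hwt]
    rw [← Fintype.sum_subtype_add_sum_subtype (fun i => i ∈ Set.range f)]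
    congr 1
    exact Eq.trans (sum_congr (by ext; simp) fun _ _ => rfl)
      ((Equiv.ofInjective f f.injective).sum_comp
        fun i : Set.range f => backDegree (G i) (η i) (z i)).symm
  have hcard : #(planeSet η f r₂ n') = #(planeSet η f r₂ n) := by
    rw [card_planeSet hn'c, card_planeSet hnc, hsum]
  refine ⟨planeSet η f r₂ n', hcard, ?_, sum_lt_of_exchange hcard ?_ ?_⟩
  · rw [hformula n hn hnc, hformula n' hn' hn'c]
    exact hΦ
  · intro heq
    obtain ⟨q, hq⟩ := hq (n' ν₁) (hν₁.trans_le (hnc ν₁))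
    obtain ⟨z, rfl, rfl⟩ := exists_coRanks (η := η)
      (fun i => mem_range.1 (Fintype.mem_piFinset.1 hν₁S i)) q
    have h₃ : z ∈ planeSet η f r₂ n := mem_planeSet.2 (hq ▸ hν₁)
    rw [← heq, mem_planeSet] at h₃
    exact absurd h₃ hq.not_lt
  · intro a' h₃ h₄ a h₅ h₆
    rw [mem_planeSet] at h₃ h₅
    rw [mem_planeSet, not_lt] at h₄ h₆
    obtain ⟨h₇, h₈, h₉⟩ := hup _ (h₄.trans_lt h₃)
    obtain ⟨h₇', h₈', h₉'⟩ := hdown _ (h₆.trans_lt h₅)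
    exact position_lt (hlt a' a h₇ h₈ (h₃.trans_le h₉) h₇' h₈' (h₉'.trans h₆))

end PlaneExchange

/-! ### Parts of one factor and their back degrees -/

section Parts

variable {V : Type u} [Fintype V] {η : V ≃ Fin (Fintype.card V)} (P : OrderedPartition η)

namespace OrderedPartition

theorem part_start (j : Fin P.numParts) : P.part (P.start j) = j :=
  Function.argminOn_mem (fun v => η v) (P.cell j) (P.surj j)

variable {P} in
theorem start_le {j : Fin P.numParts} {v : V} (hv : P.part v = j) : η (P.start j) ≤ η v :=
  Function.argminOn_le (fun v => η v) (P.cell j) hv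

theorem start_lt_start {i j : Fin P.numParts} (h : i < j) : η (P.start i) < η (P.start j) := by
  by_contra hcon
  have := P.mono _ _ (not_lt.1 hcon)
  rw [part_start, part_start] at this
  exact absurd h this.not_gt

theorem lt_of_part_lt {u v : V} (h : P.part u < P.part v) : η u < η v := by
  by_contra hcon
  exact absurd h (P.mono _ _ (not_lt.1 hcon)).not_gt

theorem card_filter_cell (v : V) :
    #{u : P.cell (P.part v) | η u.1 < η v} = (η v : ℕ) - η (P.start (P.part v)) := by
  rw [← Nat.card_Ico, ← card_map (s := ({u : P.cell (P.part v) | η u.1 < η v} : Finset _))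
    ⟨fun u => (η u.1 : ℕ), fun a b h => Subtype.ext (η.injective (Fin.ext h))⟩]
  congr 1
  ext a
  simp only [mem_map, mem_filter, mem_univ, true_and, mem_Ico]
  constructor
  · rintro ⟨u, hu, rfl⟩
    exact ⟨start_le u.2, hu⟩
  · rintro ⟨h₁, h₂⟩
    obtain ⟨u, hu⟩ := η.surjective ⟨a, h₂.trans (η v).2⟩
    have h₃ : (η u : ℕ) = a := congrArg Fin.val hu
    refine ⟨⟨u, le_antisymm (P.mono _ _ ?_) ?_⟩, ?_, h₃⟩
    · exact Fin.le_def.2 (h₃ ▸ h₂.le)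
    · have := P.mono (P.start (P.part v)) u (Fin.le_def.2 (h₃ ▸ h₁))
      rwa [part_start] at this
    · exact Fin.lt_def.2 (h₃ ▸ h₂)

theorem part_eq_iff (v : V) (j : Fin P.numParts) : P.part v = j ↔
    (η (P.start j) : ℕ) ≤ η v ∧ (η v : ℕ) < η (P.start j) + Fintype.card (P.cell j) := by
  constructor
  · rintro rfl
    have h₁ : η (P.start (P.part v)) ≤ η v := start_le rfl
    refine ⟨h₁, ?_⟩
    have h₂ := P.card_filter_cell v
    have h₃ : #{u : P.cell (P.part v) | η u.1 < η v} < Fintype.card (P.cell (P.part v)) :=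
      card_lt_univ_of_notMem (x := ⟨v, rfl⟩) (by simp)
    rw [h₂] at h₃
    have := Fin.le_def.1 h₁
    omega
  · rintro ⟨h₁, h₂⟩
    have h₃ := P.mono _ _ (Fin.le_def.2 h₁)
    rw [part_start] at h₃
    refine le_antisymm (not_lt.1 fun h₄ => ?_) h₃
    have h₅ : (univ : Finset (P.cell j)).map
        ⟨fun u => (η u.1 : ℕ), fun a b h => Subtype.ext (η.injective (Fin.ext h))⟩ ⊆
        Ico (η (P.start j) : ℕ) (η v) := by
      intro a ha
      simp only [mem_map, mem_univ, true_and] at ha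
      obtain ⟨u, rfl⟩ := ha
      have hu : P.part u.1 = j := u.2
      exact mem_Ico.2 ⟨start_le hu, P.lt_of_part_lt (hu.symm ▸ h₄)⟩
    have h₆ : Fintype.card (P.cell j) ≤ (η v : ℕ) - η (P.start j) := by
      simpa using card_le_card h₅
    have := Fin.lt_def.1 (P.lt_of_part_lt ((P.part_start j).symm ▸ h₄))
    omega

variable {P}

theorem card_cross {G : SimpleGraph V} (v : V) (j : Fin P.numParts) :
    (edgesBetween G {a | P.part a < j} {v}).ncard = #{u | P.part u < j ∧ G.Adj u v} := by
  have h : edgesBetween G {a | P.part a < j} {v} =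
      (fun u => s(u, v)) '' (({u | P.part u < j ∧ G.Adj u v} : Finset V) : Set V) := by
    ext e
    constructor
    · rintro ⟨he, a, ha, b, hb, rfl⟩
      obtain rfl : b = v := hb
      exact ⟨a, by simpa using ⟨ha, he⟩, rfl⟩
    · rintro ⟨a, ha, rfl⟩
      simp only [coe_filter, mem_univ, true_and, Set.mem_ofPred_eq] at ha
      exact ⟨ha.2, a, ha.1, v, rfl, rfl⟩
  rw [h, Set.ncard_image_of_injective _ fun a b hab => Sym2.congr_left.1 hab, Set.ncard_coe_finset]

theorem IsIsoperimetric.card_cross {G : SimpleGraph V} (hP : P.IsIsoperimetric G) (v : V) :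
    (#{u | P.part u < P.part v ∧ G.Adj u v} : ℤ) =
      delta G ((η (P.start (P.part v)) : ℕ) + 1) := by
  rw [← hP.cross (P.part v) v rfl, OrderedPartition.card_cross]

theorem IsIsoperimetric.backDegree_eq {G : SimpleGraph V} (hP : P.IsIsoperimetric G) (v : V) :
    (backDegree G η v : ℤ) = delta G ((η (P.start (P.part v)) : ℕ) + 1) +
      delta (G.induce (P.cell (P.part v))) ((η v : ℕ) - η (P.start (P.part v)) + 1) := by
  have h₁ : backDegree G η v = #{u | P.part u < P.part v ∧ G.Adj u v} +
      #{u : P.cell (P.part v) |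
        (G.induce (P.cell (P.part v))).Adj u ⟨v, rfl⟩ ∧ η u.1 < η v} := by
    have h₂ : #{u : P.cell (P.part v) |
        (G.induce (P.cell (P.part v))).Adj u ⟨v, rfl⟩ ∧ η u.1 < η v} =
        #{u | P.part u = P.part v ∧ G.Adj u v ∧ η u < η v} := by
      rw [← card_map (Function.Embedding.subtype _)]
      congr 1
      ext u
      simp only [mem_map, mem_filter, mem_univ, true_and, Function.Embedding.subtype_apply,
        SimpleGraph.comap_adj]
      constructor
      · rintro ⟨⟨w, hw⟩, h, rfl⟩
        exact ⟨hw, h⟩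
      · rintro ⟨h, h'⟩
        exact ⟨⟨u, h⟩, h', rfl⟩
    rw [h₂, backDegree, ← card_union_of_disjoint]
    · congr 1
      ext u
      simp only [mem_filter, mem_union, mem_univ, true_and]
      constructor
      · rintro ⟨h₃, h₄⟩
        rcases (P.mono _ _ h₄.le).lt_or_eq with h | h
        · exact Or.inl ⟨h, h₃⟩
        · exact Or.inr ⟨h, h₃, h₄⟩
      · rintro (⟨h₃, h₄⟩ | ⟨-, h₃⟩)
        · exact ⟨h₄, P.lt_of_part_lt h₃⟩
        · exact h₃
    · rw [disjoint_left]
      intro u h h'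
      simp only [mem_filter, mem_univ, true_and] at h h'
      exact h.1.ne h'.1
  have h₃ := (hP.optimal (P.part v)).card_filter_adj ⟨v, rfl⟩
  have h₄ : position (fun a b : P.cell (P.part v) => rankLT η a.1 b.1) ⟨v, rfl⟩ =
      (η v : ℕ) - η (P.start (P.part v)) := by
    rw [← P.card_filter_cell v, position]
    congr
  rw [h₄] at h₃
  rw [h₁, Nat.cast_add, hP.card_cross, ← h₃]
  congr

end OrderedPartition

theorem deltaSeq_getElem? {W : Type u} [Fintype W] (G : SimpleGraph W) {a : ℕ}
    (ha : a < Fintype.card W) : (deltaSeq G)[a]? = some (delta G (a + 1)) := by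
  simp [deltaSeq, ha]

theorem length_deltaSeq {W : Type u} [Fintype W] (G : SimpleGraph W) :
    (deltaSeq G).length = Fintype.card W := by
  simp [deltaSeq]

theorem delta_le_delta {W : Type u} [Fintype W] {G : SimpleGraph W}
    (h : (deltaSeq G).Pairwise (· ≤ ·)) {a b : ℕ} (hab : a ≤ b) (hb : b < Fintype.card W) :
    delta G (a + 1) ≤ delta G (b + 1) := by
  rcases hab.lt_or_eq with hab | rfl
  · have := List.pairwise_iff_getElem.1 h a b (by rw [length_deltaSeq]; omega)
      (by rw [length_deltaSeq]; omega) hab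
    simpa [deltaSeq] using this
  · rfl

namespace OrderedPartition

variable {P}

/-- The contribution of earlier parts depends only on the part and vanishes for the first one. The
contribution of the own part is the entry of the common δ-sequence at the offset from the start, and
`huv` compares these offsets. -/
theorem IsIsoperimetric.backDegree_le {G : SimpleGraph V} (hP : P.IsIsoperimetric G)
    (hmono : P.IsNonDecreasing G) {u v : V}
    (hc : P.part u = P.part v ∨ (P.part u : ℕ) = 0)
    (hδ : deltaSeq (G.induce (P.cell (P.part u))) = deltaSeq (G.induce (P.cell (P.part v))))
    (huv : (η u : ℕ) + η (P.start (P.part v)) ≤ η v + η (P.start (P.part u))) :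
    backDegree G η u ≤ backDegree G η v := by
  have h₁ : delta G ((η (P.start (P.part u)) : ℕ) + 1) ≤
      delta G ((η (P.start (P.part v)) : ℕ) + 1) := by
    rcases hc with h | h
    · rw [h]
    · rw [← hP.card_cross u, ← hP.card_cross v]
      have : ({w | P.part w < P.part u ∧ G.Adj w u} : Finset V) = ∅ := by
        ext w
        simp only [mem_filter, mem_univ, true_and, notMem_empty, iff_false, not_and]
        intro hw
        rw [Fin.lt_def, h] at hw
        exact absurd hw (Nat.not_lt_zero _)
      rw [this]
      simp
  obtain ⟨h₂, h₃⟩ := (P.part_eq_iff u _).1 rfl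
  obtain ⟨h₄, h₅⟩ := (P.part_eq_iff v _).1 rfl
  have hcard := congrArg List.length hδ
  rw [length_deltaSeq, length_deltaSeq] at hcard
  have h₆ : delta (G.induce (P.cell (P.part u))) ((η u : ℕ) - η (P.start (P.part u)) + 1) =
      delta (G.induce (P.cell (P.part v))) ((η u : ℕ) - η (P.start (P.part u)) + 1) := by
    have h₇ := congrArg (fun L : List ℤ => L[(η u : ℕ) - η (P.start (P.part u))]?) hδ
    beta_reduce at h₇
    rw [deltaSeq_getElem? _ (by omega), deltaSeq_getElem? _ (by omega)] at h₇
    exact Option.some.inj h₇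
  have h₈ := delta_le_delta (hmono (P.part v))
    (a := (η u : ℕ) - η (P.start (P.part u))) (b := (η v : ℕ) - η (P.start (P.part v)))
    (by omega) (by omega)
  have h₉ := hP.backDegree_eq u
  have h₁₀ := hP.backDegree_eq v
  rw [h₆] at h₉
  omega

end OrderedPartition

end Parts

/-! ### The block-lexicographic order -/

section BlockLex

variable {d : ℕ} {V : Fin d → Type u} [∀ i, Fintype (V i)]
  {η : ∀ i, V i ≃ Fin (Fintype.card (V i))} {G : ∀ i, SimpleGraph (V i)}
  {P : ∀ i, OrderedPartition (η i)} (D : DominationCollection G P) {k : ℕ} (e : Fin k ↪o Fin d)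

/-- The tuple of the numbers of the parts of the coordinates. -/
def partIndex (P : ∀ i, OrderedPartition (η i)) (e : Fin k ↪o Fin d) (x : ∀ j, V (e j)) :
    Fin k → ℕ :=
  fun j => ((P (e j)).part (x j) : ℕ)

variable {e} in
theorem blockOf_eq_iff {x y : ∀ j, V (e j)} :
    blockOf P e x = blockOf P e y ↔ partIndex P e x = partIndex P e y :=
  ⟨fun h => funext fun j => congrArg Fin.val (congrFun h j),
    fun h => funext fun j => Fin.ext (congrFun h j)⟩

variable {e} in
-- Ranks of starts increase strictly with the number of the part, so starts may be replaced by part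
-- numbers throughout.
theorem lexLT_blockStart_iff {x y : ∀ j, V (e j)} :
    lexLT (ranks η e (blockStart P e (blockOf P e x)))
      (ranks η e (blockStart P e (blockOf P e y))) ↔
      lexLT (partIndex P e x) (partIndex P e y) := by
  have h₁ : ∀ j (a b : Fin (P (e j)).numParts),
      ((η (e j) ((P (e j)).start a) : ℕ) = η (e j) ((P (e j)).start b) ↔ (a : ℕ) = b) := by
    intro j a b
    rw [← Fin.ext_iff, ← Fin.ext_iff]
    refine ⟨fun h => ?_, fun h => h ▸ rfl⟩
    rcases lt_trichotomy a b with h' | h' | h'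
    · exact absurd h ((P (e j)).start_lt_start h').ne
    · exact h'
    · exact absurd h ((P (e j)).start_lt_start h').ne'
  have h₂ : ∀ j (a b : Fin (P (e j)).numParts),
      ((η (e j) ((P (e j)).start a) : ℕ) < η (e j) ((P (e j)).start b) ↔ (a : ℕ) < b) := by
    intro j a b
    rw [← Fin.lt_def, ← Fin.lt_def]
    refine ⟨fun h => ?_, fun h => (P (e j)).start_lt_start h⟩
    by_contra hcon
    rcases (not_lt.1 hcon).lt_or_eq with h' | rfl
    · exact absurd h ((P (e j)).start_lt_start h').not_gt
    · exact lt_irrefl _ h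
  exact exists_congr fun i => and_congr
    (forall_congr' fun j => imp_congr_right fun _ => h₁ j _ _) (h₂ i _ _)

/-- A key for the block-lexicographic order in a linear order. -/
noncomputable def blockLexKey (x : ∀ j, V (e j)) : Lex (Fin k → ℕ) ×ₗ Lex (Fin k → ℕ) :=
  toLex (toLex (partIndex P e x),
    toLex fun i => ranks η e x (D.perm e (blockOf P e x) i))

variable {e}

theorem blockLexLT_iff {x y : ∀ j, V (e j)} :
    blockLexLT D e x y ↔ blockLexKey D e x < blockLexKey D e y := by
  rw [blockLexKey, blockLexKey, Prod.Lex.toLex_lt_toLex, blockLexLT, lexLT_blockStart_iff]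
  constructor
  · rintro (⟨h₁, h₂⟩ | ⟨h₁, h₂⟩)
    · refine Or.inr ⟨congrArg toLex (blockOf_eq_iff.1 h₁), ?_⟩
      rw [← h₁]
      exact h₂
    · exact Or.inl h₂
  · rintro (h₁ | ⟨h₁, h₂⟩)
    · refine Or.inr ⟨fun h => ?_, h₁⟩
      rw [blockOf_eq_iff.1 h] at h₁
      exact lt_irrefl _ h₁
    · have h : blockOf P e x = blockOf P e y := blockOf_eq_iff.2 (toLex.injective h₁)
      refine Or.inl ⟨h, ?_⟩
      rw [← h] at h₂
      exact h₂

theorem blockLexKey_injective : Function.Injective (blockLexKey D e) := by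
  intro x y h
  rw [blockLexKey, blockLexKey] at h
  have h' := Prod.ext_iff.1 (toLex.injective h)
  have h₁ : blockOf P e x = blockOf P e y := blockOf_eq_iff.2 (toLex.injective h'.1)
  have h₂ := toLex.injective h'.2
  rw [h₁] at h₂
  ext j
  have h₃ := congrFun h₂ ((D.perm e (blockOf P e y)).symm j)
  simp only [Equiv.apply_symm_apply] at h₃
  exact (η (e j)).injective (Fin.ext h₃)

theorem isStrictTotalOrder_blockLexLT : IsStrictTotalOrder (∀ j, V (e j)) (blockLexLT D e) where
  trichotomous x y h h' := by
    rw [blockLexLT_iff] at h h'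
    exact blockLexKey_injective D (le_antisymm (not_lt.1 h') (not_lt.1 h))
  irrefl x h := lt_irrefl _ ((blockLexLT_iff D).1 h)
  trans x y z h h' := (blockLexLT_iff D).2
    (((blockLexLT_iff D).1 h).trans ((blockLexLT_iff D).1 h'))

theorem blockLexLT_of_partIndex {x y : ∀ j, V (e j)}
    (h : toLex (partIndex P e x) < toLex (partIndex P e y)) : blockLexLT D e x y := by
  rw [blockLexLT_iff, blockLexKey, blockLexKey, Prod.Lex.toLex_lt_toLex]
  exact Or.inl h

theorem partIndex_le_of_blockLexLT {x y : ∀ j, V (e j)} (h : blockLexLT D e x y) :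
    toLex (partIndex P e x) ≤ toLex (partIndex P e y) := by
  rw [blockLexLT_iff, blockLexKey, blockLexKey, Prod.Lex.toLex_lt_toLex] at h
  exact h.elim le_of_lt fun h => h.1.le

theorem partIndex_mono {x y : ∀ j, V (e j)} (h : ∀ j, η (e j) (x j) ≤ η (e j) (y j)) :
    partIndex P e x ≤ partIndex P e y :=
  fun j => Fin.le_def.1 ((P (e j)).mono _ _ (h j))

theorem blockLexLT_of_le {x y : ∀ j, V (e j)} (h : ∀ j, η (e j) (x j) ≤ η (e j) (y j))
    (hne : x ≠ y) : blockLexLT D e x y := by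
  by_cases hb : partIndex P e x = partIndex P e y
  · rw [blockLexLT_iff]
    refine lt_of_le_of_ne ?_ fun h => hne (blockLexKey_injective D h)
    rw [blockLexKey, blockLexKey, blockOf_eq_iff.2 hb, hb, Prod.Lex.toLex_le_toLex]
    exact Or.inr ⟨rfl, Pi.toLex_monotone fun i => h _⟩
  · exact blockLexLT_of_partIndex D
      (lt_of_le_of_ne (Pi.toLex_monotone (partIndex_mono h)) fun h => hb (toLex.injective h))

/-- The block-lexicographic orders of `G_S` and of its subproducts are consistent. -/
theorem blockLexLT_restrict {k₁ : ℕ} (hk : 0 < k₁) (f : Fin k₁ ↪o Fin k) {x y : ∀ j, V (e j)}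
    (hxy : ∀ j, j ∉ Set.range f → x j = y j) (h : blockLexLT D e x y) :
    blockLexLT D (f.trans e) (fun j => x (f j)) fun j => y (f j) := by
  rcases h with ⟨h₁, h₂⟩ | ⟨h₁, h₂⟩
  · exact Or.inl ⟨funext fun j => congrFun h₁ (f j),
      D.consistent hk f e (blockOf P e x) x (fun _ => rfl) y
        (fun j => (congrFun h₁ j).symm) hxy h₂⟩
  · rw [lexLT_blockStart_iff] at h₂
    obtain ⟨i, hi, hlt⟩ := h₂
    have hir : i ∈ Set.range f := by
      by_contra hir
      rw [partIndex, partIndex, hxy i hir] at hlt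
      exact lt_irrefl _ hlt
    obtain ⟨j, rfl⟩ := hir
    exact blockLexLT_of_partIndex D ⟨j, fun l hl => hi (f l) (f.lt_iff_lt.2 hl), hlt⟩

end BlockLex

/-! ### Optimality from local improvements -/

section Improvement

variable {α : Type u} [Fintype α]

/-- A total order is optimal if every set that is not an initial segment can be moved down without
losing induced edges. -/
theorem isOptimalOrder_of_improvement {G : SimpleGraph α} {r : α → α → Prop}
    (hr : IsStrictTotalOrder α r)
    (h : ∀ A : Finset α, (∃ a b, r a b ∧ b ∈ A ∧ a ∉ A) →
      ∃ A' : Finset α, #A' = #A ∧ numInduced G A ≤ numInduced G A' ∧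
        ∑ z ∈ A', position r z < ∑ z ∈ A, position r z) :
    IsOptimalOrder G r := by
  refine ⟨hr, fun B hB => le_antisymm (numInduced_le_maxInduced G B) (Finset.sup_le fun S hS => ?_)⟩
  obtain ⟨A, hA, hmin⟩ := exists_min_image
    ({A | #A = #S ∧ numInduced G S ≤ numInduced G A} : Finset (Finset α))
    (fun A => ∑ z ∈ A, position r z) ⟨S, by simp⟩
  simp only [mem_filter, mem_univ, true_and] at hA hmin
  have hlow : ∀ a b, r a b → b ∈ A → a ∈ A := by
    intro a b hab hb
    by_contra ha
    obtain ⟨A', h₁, h₂, h₃⟩ := h A ⟨a, b, hab, hb, ha⟩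
    exact absurd (hmin A' ⟨h₁.trans hA.1, hA.2.trans h₂⟩) h₃.not_ge
  rw [eq_initSeg hB, ← (mem_powersetCard.1 hS).2, ← hA.1, ← eq_initSeg hlow]
  exact hA.2

theorem numInduced_induce (G : SimpleGraph α) (s : Set α) [Fintype s] (T : Finset s) :
    numInduced (G.induce s) T = numInduced G (T.map (Function.Embedding.subtype _)) := by
  refine Nat.eq_of_mul_eq_mul_left zero_lt_two ?_
  rw [two_mul_numInduced, two_mul_numInduced, sum_map]
  refine sum_congr rfl fun z _ => ?_
  rw [filter_map, card_map]
  rfl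

end Improvement

/-! ### First gap and last vertex in one block -/

section SameBlock

variable {d : ℕ} {V : Fin d → Type u} [∀ i, Fintype (V i)]
  {η : ∀ i, V i ≃ Fin (Fintype.card (V i))} {G : ∀ i, SimpleGraph (V i)}
  {P : ∀ i, OrderedPartition (η i)} {k : ℕ} {e : Fin k ↪o Fin d}

theorem partIndex_update (z : ∀ j, V (e j)) (j : Fin k) (v : V (e j)) :
    partIndex P e (Function.update z j v) =
      Function.update (partIndex P e z) j ((P (e j)).part v : ℕ) := by
  ext i
  by_cases h : i = j
  · subst h; simp [partIndex]
  · simp [partIndex, h]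

theorem card_adj_earlier (z : ∀ j, V (e j)) :
    #{u : ∀ j, V (e j) | toLex (partIndex P e u) < toLex (partIndex P e z) ∧
      (boxPi fun j => G (e j)).Adj u z} =
    ∑ j, #{v | (P (e j)).part v < (P (e j)).part (z j) ∧ (G (e j)).Adj v (z j)} := by
  have h : ({u : ∀ j, V (e j) | toLex (partIndex P e u) < toLex (partIndex P e z) ∧
      (boxPi fun j => G (e j)).Adj u z} : Finset (∀ j, V (e j))) = univ.biUnion fun j =>
      ({v | (P (e j)).part v < (P (e j)).part (z j) ∧ (G (e j)).Adj v (z j)} :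
        Finset (V (e j))).image (Function.update z j) := by
    ext u
    simp only [mem_filter, mem_biUnion, mem_image, mem_univ, true_and]
    constructor
    · rintro ⟨hlt, j, hadj, hj⟩
      have hup : Function.update z j (u j) = u := by
        ext i
        by_cases hij : i = j
        · subst hij; simp
        · simp [hij, hj i hij]
      rw [← hup, partIndex_update, Pi.toLex_update_lt_self_iff] at hlt
      exact ⟨j, u j, ⟨Fin.lt_def.2 hlt, hadj⟩, hup⟩
    · rintro ⟨j, v, ⟨hlt, hadj⟩, rfl⟩
      refine ⟨?_, j, by simpa using hadj, fun i hi => by simp [hi]⟩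
      rw [partIndex_update, Pi.toLex_update_lt_self_iff]
      exact Fin.lt_def.1 hlt
  rw [h, card_biUnion]
  · exact sum_congr rfl fun j _ => card_image_of_injective _ (Function.update_injective z j)
  · intro i _ j _ hij
    rw [Function.onFun, disjoint_left]
    intro u hu hu'
    simp only [mem_image, mem_filter, mem_univ, true_and] at hu hu'
    obtain ⟨v, ⟨-, hv⟩, rfl⟩ := hu
    obtain ⟨w, ⟨-, hw⟩, h⟩ := hu'
    have h1 := congrFun h i
    rw [Function.update_of_ne hij, Function.update_self] at h1
    exact hv.ne h1.symm

/-- A neighbour in an earlier block differs in one coordinate, which moves to an earlier part; the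
isoperimetric condition makes the number of such moves constant on parts. -/
theorem card_adj_earlier_eq (hP : ∀ i, (P i).IsIsoperimetric (G i)) {x z : ∀ j, V (e j)}
    (h : blockOf P e z = blockOf P e x) :
    #{u : ∀ j, V (e j) | toLex (partIndex P e u) < toLex (partIndex P e z) ∧
      (boxPi fun j => G (e j)).Adj u z} =
    #{u : ∀ j, V (e j) | toLex (partIndex P e u) < toLex (partIndex P e x) ∧
      (boxPi fun j => G (e j)).Adj u x} := by
  rw [card_adj_earlier, card_adj_earlier]
  refine sum_congr rfl fun j _ => ?_
  have h₁ : (P (e j)).part (z j) = (P (e j)).part (x j) := congrFun h j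
  have h₂ := (hP (e j)).card_cross (z j)
  have h₃ := (hP (e j)).card_cross (x j)
  rw [h₁] at h₂ ⊢
  exact_mod_cast h₂.trans h₃.symm

theorem exists_improvement_of_same_block (D : DominationCollection G P) (hk : 0 < k)
    (hP : ∀ i, (P i).IsIsoperimetric (G i)) {A : Finset (∀ j, V (e j))} {x y : ∀ j, V (e j)}
    (hxA : x ∉ A) (hyA : y ∈ A) (hxy : blockLexLT D e x y)
    (hblock : blockOf P e x = blockOf P e y)
    (hx : ∀ z, blockLexLT D e z x → z ∈ A) (hy : ∀ z, blockLexLT D e y z → z ∉ A) :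
    ∃ A' : Finset (∀ j, V (e j)), #A' = #A ∧
      numInduced (boxPi fun j => G (e j)) A ≤ numInduced (boxPi fun j => G (e j)) A' ∧
      ∑ z ∈ A', position (blockLexLT D e) z < ∑ z ∈ A, position (blockLexLT D e) z := by
  have := isStrictTotalOrder_blockLexLT D (e := e)
  have hopt := D.optimal hk e (blockOf P e x)
  have := hopt.strictTotal
  set r : block P e (blockOf P e x) → block P e (blockOf P e x) → Prop := fun a b =>
    domLT (D.perm e (blockOf P e x)) (ranks η e a.1) (ranks η e b.1) with hr
  have hmem : ∀ z, z ∈ block P e (blockOf P e x) ↔ blockOf P e z = blockOf P e x :=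
    fun z => funext_iff.symm
  have hrBL : ∀ a b, r a b → blockLexLT D e a.1 b.1 := by
    intro a b hab
    have ha := (hmem a.1).1 a.2
    have hb := (hmem b.1).1 b.2
    refine Or.inl ⟨ha.trans hb.symm, ?_⟩
    rw [ha]
    exact hab
  -- All earlier blocks lie in A because x is the first gap, and no later block meets A because y is
  -- its last vertex. Only the trace S of A on the common block can be rearranged.
  let U : Finset (∀ j, V (e j)) := {u | toLex (partIndex P e u) < toLex (partIndex P e x)}
  let S : Finset (block P e (blockOf P e x)) := {z | z.1 ∈ A}
  let ι : block P e (blockOf P e x) ↪ (∀ j, V (e j)) := Function.Embedding.subtype _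
  have hidx : ∀ z : block P e (blockOf P e x), partIndex P e z.1 = partIndex P e x := fun z =>
    blockOf_eq_iff.1 ((hmem z.1).1 z.2)
  have hdis : ∀ T : Finset (block P e (blockOf P e x)), Disjoint U (T.map ι) := by
    intro T
    rw [disjoint_left]
    intro u hu hu'
    obtain ⟨z, -, rfl⟩ := mem_map.1 hu'
    have h₁ : toLex (partIndex P e z.1) < toLex (partIndex P e x) := by simpa [U, ι] using hu
    rw [hidx z] at h₁
    exact lt_irrefl _ h₁
  have hAU : A = U ∪ S.map ι := by
    ext z
    simp only [mem_union, mem_map, U, S, mem_filter, mem_univ, true_and]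
    constructor
    · intro hz
      rcases lt_trichotomy (toLex (partIndex P e z)) (toLex (partIndex P e x)) with h | h | h
      · exact Or.inl h
      · exact Or.inr ⟨⟨z, (hmem z).2 (blockOf_eq_iff.2 (toLex.injective h))⟩, hz, rfl⟩
      · rw [blockOf_eq_iff.1 hblock] at h
        exact absurd hz (hy z (blockLexLT_of_partIndex D h))
    · rintro (h | ⟨w, hw, rfl⟩)
      · exact hx z (blockLexLT_of_partIndex D h)
      · exact hw
  have hκ : ∀ T : Finset (block P e (blockOf P e x)), ∀ z ∈ T.map ι,
      #{u ∈ U | (boxPi fun j => G (e j)).Adj u z} =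
        #{u : ∀ j, V (e j) | toLex (partIndex P e u) < toLex (partIndex P e x) ∧
          (boxPi fun j => G (e j)).Adj u x} := by
    intro T z hz
    obtain ⟨w, -, rfl⟩ := mem_map.1 hz
    rw [← card_adj_earlier_eq hP ((hmem w.1).1 w.2), filter_filter, hidx w]
    rfl
  have hcard : #(initSeg r #S) = #S := card_initSeg (card_le_univ S)
  have hcard' : #(U ∪ (initSeg r #S).map ι) = #A := by
    rw [hAU, card_union_of_disjoint (hdis _), card_union_of_disjoint (hdis _), card_map, card_map,
      hcard]
  refine ⟨U ∪ (initSeg r #S).map ι, hcard', ?_, sum_lt_of_exchange hcard' ?_ ?_⟩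
  · conv_lhs => rw [hAU]
    rw [numInduced_union _ (hdis _) (hκ _), numInduced_union _ (hdis _) (hκ _), card_map, card_map,
      hcard, ← numInduced_induce, ← numInduced_induce]
    have := hopt.numInduced_le S
    omega
  · intro heq
    have hy' : (⟨y, (hmem y).2 hblock.symm⟩ : block P e (blockOf P e x)) ∈ initSeg r #S := by
      rw [← heq, mem_union, mem_map] at hyA
      rcases hyA with h | ⟨w, hw, rfl⟩
      · have h₁ : toLex (partIndex P e y) < toLex (partIndex P e x) := by simpa [U] using h
        rw [blockOf_eq_iff.1 hblock] at h₁
        exact absurd h₁ (lt_irrefl _)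
      · exact hw
    have hx' : (⟨x, (hmem x).2 rfl⟩ : block P e (blockOf P e x)) ∈ initSeg r #S := by
      refine initSeg_lower _ _ ?_ hy'
      rcases hxy with h | h
      · exact h.2
      · exact absurd hblock h.1
    refine hxA (heq ▸ mem_union_right _ (mem_map.2 ⟨_, hx', rfl⟩))
  · intro a' ha' ha'A a ha haA'
    rw [hAU, mem_union, not_or] at ha'A
    rw [mem_union, not_or] at haA'
    obtain ⟨w', hw', rfl⟩ := mem_map.1 ((mem_union.1 ha').resolve_left ha'A.1)
    rw [hAU, mem_union] at ha
    obtain ⟨w, hw, rfl⟩ := mem_map.1 (ha.resolve_left haA'.1)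
    refine position_lt (hrBL w' w (position_lt_iff.1 ((mem_initSeg.1 hw').trans_le ?_)))
    by_contra hcon
    exact haA'.2 (mem_map.2 ⟨w, mem_initSeg.2 (not_le.1 hcon), rfl⟩)

end SameBlock

/-! ### Sets that are not compressed -/

section Compressed

variable {d : ℕ} {V : Fin d → Type u} [∀ i, Fintype (V i)]
  {η : ∀ i, V i ≃ Fin (Fintype.card (V i))} {G : ∀ i, SimpleGraph (V i)}
  {P : ∀ i, OrderedPartition (η i)} {m : ℕ} {e : Fin (m + 1) ↪o Fin d}

theorem exists_improvement_of_not_compressed (D : DominationCollection G P) (hm : 0 < m)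
    (h : ∀ e' : Fin m ↪o Fin d, IsOptimalOrder (boxPi fun j => G (e' j)) (blockLexLT D e'))
    {A : Finset (∀ j, V (e j))}
    (hA : ∃ z z', (∃ i, z i = z' i) ∧ blockLexLT D e z z' ∧ z' ∈ A ∧ z ∉ A) :
    ∃ A' : Finset (∀ j, V (e j)), #A' = #A ∧
      numInduced (boxPi fun j => G (e j)) A ≤ numInduced (boxPi fun j => G (e j)) A' ∧
      ∑ z ∈ A', position (blockLexLT D e) z < ∑ z ∈ A, position (blockLexLT D e) z := by
  obtain ⟨z, z', ⟨i, hi⟩, hlt, hz', hz⟩ := hA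
  have := isStrictTotalOrder_blockLexLT D (e := e)
  have hopt := h ((Fin.succAboveOrderEmb i).trans e)
  have hst := hopt.strictTotal
  have hins : ∀ w : ∀ j, V (e j),
      w = i.insertNth (α := fun j => V (e j)) (w i) fun j => w (i.succAbove j) := fun w =>
    (Fin.insertNth_self_removeNth (α := fun j => V (e j)) i w).symm
  have hout : ∀ j, j ∉ Set.range (Fin.succAboveOrderEmb i) → j = i := by
    intro j hj
    by_contra hne
    obtain ⟨l, rfl⟩ := Fin.exists_succAbove_eq hne
    exact hj ⟨l, rfl⟩
  have hres : ∀ w w' : ∀ j, V (e j), w i = w' i → blockLexLT D e w w' →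
      blockLexLT D ((Fin.succAboveOrderEmb i).trans e) (fun j => w (i.succAbove j))
        fun j => w' (i.succAbove j) := fun w w' hw hlt =>
    blockLexLT_restrict D hm (Fin.succAboveOrderEmb i) (fun j hj => hout j hj ▸ hw) hlt
  refine ⟨compress (V := fun j => V (e j)) i (blockLexLT D ((Fin.succAboveOrderEmb i).trans e)) A,
    card_compress (V := fun j => V (e j)) i hst A,
    numInduced_le_compress (V := fun j => V (e j)) (G := fun j => G (e j)) i hopt A,
    sum_compress_lt (V := fun j => V (e j)) i hst A (fun v q q' hq => position_lt ?_)
      ⟨z i, fun j => z (i.succAbove j), fun j => z' (i.succAbove j), hres z z' hi hlt, ?_, ?_⟩⟩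
  · rcases trichotomous_of (blockLexLT D e) (i.insertNth (α := fun j => V (e j)) v q)
      (i.insertNth (α := fun j => V (e j)) v q') with h₁ | h₁ | h₁
    · exact h₁
    · obtain ⟨-, rfl⟩ := Fin.insertNth_inj.1 h₁
      exact absurd hq (hst.irrefl _)
    · have h₂ := hres _ _ (by simp) h₁
      simp only [Fin.insertNth_apply_succAbove] at h₂
      exact absurd (hst.trans _ _ _ hq h₂) (hst.irrefl _)
  · rw [hi, ← hins z']
    exact hz'
  · rw [← hins z]
    exact hz

end Compressed

/-! ### A lexicographic criterion -/

section Lex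

variable {k : ℕ}

/-- A difference before L decides, whatever happens from L on. With L the last coordinate, this
leaves the last coordinate of the plane free. -/
theorem toLex_lt_of_forall_lt {a b : Fin k → ℕ} {L : Fin k} (hle : ∀ i < L, a i ≤ b i)
    (hne : ∃ i < L, a i ≠ b i) : toLex a < toLex b := by
  obtain ⟨i, ⟨hi, hne⟩, hmin⟩ := WellFounded.has_min (wellFounded_lt (α := Fin k))
    {i | i < L ∧ a i ≠ b i} hne
  refine ⟨i, fun j hj => ?_, lt_of_le_of_ne (hle i hi) hne⟩
  by_contra hcon
  exact hmin j ⟨hj.trans hi, hcon⟩ hj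

end Lex

/-! ### The exchange between two blocks -/

section DifferentBlocks

variable {d : ℕ} {V : Fin d → Type u} [∀ i, Fintype (V i)]
  {η : ∀ i, V i ≃ Fin (Fintype.card (V i))} {G : ∀ i, SimpleGraph (V i)}
  {P : ∀ i, OrderedPartition (η i)} {k : ℕ} {e : Fin k ↪o Fin d}

theorem OrderedPartition.start_add_card_le {W : Type u} [Fintype W]
    {θ : W ≃ Fin (Fintype.card W)} (Q : OrderedPartition θ) (j : Fin Q.numParts) :
    (θ (Q.start j) : ℕ) + Fintype.card (Q.cell j) ≤ Fintype.card W := by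
  have h : (univ : Finset (Q.cell j)).map
      ⟨fun u => (θ u.1 : ℕ), fun a b h => Subtype.ext (θ.injective (Fin.ext h))⟩ ⊆
      Ico (θ (Q.start j) : ℕ) (Fintype.card W) := by
    intro a ha
    simp only [mem_map, mem_univ, true_and] at ha
    obtain ⟨u, rfl⟩ := ha
    have hu : Q.part u.1 = j := u.2
    exact mem_Ico.2 ⟨OrderedPartition.start_le hu, (θ u.1).2⟩
  have h₁ : Fintype.card (Q.cell j) ≤ Fintype.card W - θ (Q.start j) := by
    simpa using card_le_card h
  have := (θ (Q.start j)).2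
  omega

/-- The exchange between two blocks. Outside of the plane of `f`, a coordinate of the blocks is
either the same or passes from the last part to the first one. -/
theorem exists_improvement_of_blocks (D : DominationCollection G P)
    (hP : ∀ i, (P i).IsIsoperimetric (G i)) {f : Fin 2 ↪o Fin k} (hf : ∃ i, i ∉ Set.range f)
    (h₂ : IsOptimalOrder (boxPi fun j => G (e (f j))) (blockLexLT D (f.trans e)))
    {A : Finset (∀ j, V (e j))}
    (hA : ∀ z z', (∃ i, z i = z' i) → blockLexLT D e z z' → z' ∈ A → z ∈ A)
    {x y : ∀ j, V (e j)} (hxA : x ∉ A) (hyA : y ∈ A)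
    (hx : ∀ z, blockLexLT D e z x → z ∈ A) (hy : ∀ z, blockLexLT D e y z → z ∉ A)
    (hmono : ∀ i, i ∉ Set.range f → (P (e i)).IsNonDecreasing (G (e i)))
    (hpart : ∀ i, i ∉ Set.range f → (P (e i)).part (x i) = (P (e i)).part (y i) ∨
      ((P (e i)).part (y i) : ℕ) = 0 ∧ ((P (e i)).part (x i) : ℕ) + 1 = (P (e i)).numParts ∧
        (P (e i)).IsRegular (G (e i)))
    {H : ℕ → ℕ → Prop}
    (hH : ∀ a b a' b', a < a' ∨ a = a' ∧ b ≤ b' → H a' b' → H a b)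
    (hHx : H (partIndex P e x (f 0)) (partIndex P e x (f 1)))
    (hHy : ¬ H (partIndex P e y (f 0)) (partIndex P e y (f 1)))
    (habove : ∀ a : Fin k → ℕ, (∀ i, i ∉ Set.range f → partIndex P e y i ≤ a i) →
      (∃ i, i ∉ Set.range f ∧ partIndex P e y i ≠ a i) → ¬ H (a (f 0)) (a (f 1)) →
      toLex (partIndex P e y) < toLex a)
    (hbelow : ∀ a : Fin k → ℕ, (∀ i, i ∉ Set.range f → a i ≤ partIndex P e x i) →
      (∃ i, i ∉ Set.range f ∧ a i ≠ partIndex P e x i) → H (a (f 0)) (a (f 1)) →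
      toLex a < toLex (partIndex P e x))
    (hbetween : ∀ a b : Fin k → ℕ, (∀ i, i ∉ Set.range f → a i = partIndex P e x i) →
      (∀ i, i ∉ Set.range f → b i = partIndex P e y i) → H (a (f 0)) (a (f 1)) →
      ¬ H (b (f 0)) (b (f 1)) → toLex a < toLex b) :
    ∃ A' : Finset (∀ j, V (e j)), #A' = #A ∧
      numInduced (boxPi fun j => G (e j)) A ≤ numInduced (boxPi fun j => G (e j)) A' ∧
      ∑ z ∈ A', position (blockLexLT D e) z < ∑ z ∈ A, position (blockLexLT D e) z := by
  let X : ∀ i, Fin (P (e i)).numParts := fun i => (P (e i)).part (x i)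
  let Y : ∀ i, Fin (P (e i)).numParts := fun i => (P (e i)).part (y i)
  -- Equal δ-sequences also give parts of equal size, so the two boxes of ranks outside the plane
  -- are translates of each other.
  have hδ : ∀ i, i ∉ Set.range f → deltaSeq ((G (e i)).induce ((P (e i)).cell (Y i))) =
      deltaSeq ((G (e i)).induce ((P (e i)).cell (X i))) := by
    intro i hi
    rcases hpart i hi with h | ⟨h, h', hreg⟩
    · exact congrArg (fun l => deltaSeq ((G (e i)).induce ((P (e i)).cell l))) h.symm
    · exact hreg _ _ h h'
  have hcard : ∀ i, i ∉ Set.range f →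
      Fintype.card ((P (e i)).cell (Y i)) = Fintype.card ((P (e i)).cell (X i)) := by
    intro i hi
    have := congrArg List.length (hδ i hi)
    rwa [length_deltaSeq, length_deltaSeq] at this
  have hstart : ∀ i, i ∉ Set.range f →
      η (e i) ((P (e i)).start (Y i)) ≤ η (e i) ((P (e i)).start (X i)) := by
    intro i hi
    by_contra hcon
    have h₁ := (P (e i)).mono _ _ (not_le.1 hcon).le
    rw [OrderedPartition.part_start, OrderedPartition.part_start] at h₁
    rcases hpart i hi with h | ⟨h, -⟩
    · exact hcon (by simp only [X, Y, h, le_refl])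
    · have h₃ : X i = Y i := le_antisymm h₁ (Fin.le_def.2 (by simp only [Y, h, Nat.zero_le]))
      exact hcon (by rw [h₃])
  have hle : ∀ (i : Fin k) (j : Fin (P (e i)).numParts) (v : V (e i)),
      (η (e i) ((P (e i)).start j) : ℕ) ≤ η (e i) v → j ≤ (P (e i)).part v := by
    intro i j v h
    have := (P (e i)).mono _ _ (Fin.le_def.2 h)
    rwa [OrderedPartition.part_start] at this
  have hge : ∀ (i : Fin k) (j : Fin (P (e i)).numParts) (v : V (e i)),
      (η (e i) v : ℕ) < η (e i) ((P (e i)).start j) + Fintype.card ((P (e i)).cell j) →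
      (P (e i)).part v ≤ j := by
    intro i j v h
    by_contra hcon
    have h₁ := (P (e i)).lt_of_part_lt (u := (P (e i)).start j) (v := v)
      (by rw [OrderedPartition.part_start]; exact not_le.1 hcon)
    exact (not_le.1 hcon).ne' (((P (e i)).part_eq_iff v j).2 ⟨(Fin.lt_def.1 h₁).le, h⟩)
  refine exists_improvement_of_exchange (V := fun j => V (e j)) (η := fun j => η (e j)) (f := f)
    (G := fun j => G (e j)) hf (isStrictTotalOrder_blockLexLT D)
    (fun z z' => blockLexLT_of_le D) h₂ (fun q q' => blockLexLT_of_le (e := f.trans e) D)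
    (fun z z' => blockLexLT_restrict D zero_lt_two f)
    (H := fun q => H (partIndex P (f.trans e) q 0) (partIndex P (f.trans e) q 1))
    (x₀ := fun i => η (e i) ((P (e i)).start (X i))) (y₀ := fun i => η (e i) ((P (e i)).start (Y i)))
    (l := fun i => Fintype.card ((P (e i)).cell (X i)))
    ?_ (fun i => Fin.le_def.1 (hstart i i.2)) (fun i => OrderedPartition.start_add_card_le _ _)
    hA ?_ ?_ ?_ ⟨y, hyA, fun i => OrderedPartition.start_le rfl, hHy⟩ ⟨x, hxA, fun i => ?_, hHx⟩ ?_
  · intro q q' hq hq'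
    refine hH _ _ _ _ ?_ hq'
    have h := partIndex_le_of_blockLexLT D hq
    rcases h.lt_or_eq with ⟨i, h₃, h₄⟩ | h
    · fin_cases i
      · exact Or.inl h₄
      · exact Or.inr ⟨h₃ 0 Fin.zero_lt_one, le_of_lt h₄⟩
    · have h' := toLex.injective h
      exact Or.inr ⟨congrFun h' 0, (congrFun h' 1).le⟩
  · intro z hz hzY hzH i
    have h₁ : ∀ i, i ∉ Set.range f → partIndex P e y i ≤ partIndex P e z i := fun i hi =>
      Fin.le_def.1 (hle i (Y i) (z i) (Pi.le_def.1 hzY ⟨i, hi⟩))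
    by_contra hcon
    refine hy z (blockLexLT_of_partIndex D (habove _ h₁ ⟨i, i.2, fun h => hcon ?_⟩ hzH)) hz
    have h₃ : (P (e i)).part (z i) = Y i := Fin.ext h.symm
    rw [← hcard i i.2]
    exact (((P (e i)).part_eq_iff _ _).1 h₃).2
  · intro z hz hzX hzH
    have h₁ : ∀ i, i ∉ Set.range f → partIndex P e z i ≤ partIndex P e x i := fun i hi =>
      Fin.le_def.1 (hge i (X i) (z i) (hzX ⟨i, hi⟩))
    refine Pi.le_def.2 fun i => ?_
    by_contra hcon
    refine hz (hx z (blockLexLT_of_partIndex D (hbelow _ h₁ ⟨i, i.2, fun h => hcon ?_⟩ hzH)))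
    have h₃ : (P (e i)).part (z i) = X i := Fin.ext h
    exact (((P (e i)).part_eq_iff _ _).1 h₃).1
  · intro z z' h₁ h₃ h₄ h₅ h₆ h₇
    refine blockLexLT_of_partIndex D (hbetween _ _ (fun i hi => ?_) (fun i hi => ?_) h₄ h₇)
    · exact congrArg Fin.val (((P (e i)).part_eq_iff (z i) (X i)).2
        ⟨Pi.le_def.1 h₁ ⟨i, hi⟩, h₃ ⟨i, hi⟩⟩)
    · refine congrArg Fin.val (((P (e i)).part_eq_iff (z' i) (Y i)).2
        ⟨Pi.le_def.1 h₅ ⟨i, hi⟩, ?_⟩)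
      rw [hcard i hi]
      exact h₆ ⟨i, hi⟩
  · exact (((P (e i)).part_eq_iff (x i) (X i)).1 rfl).2
  · intro i u v h₁ h₃ h₄ h₅ h₆
    rw [← hcard i i.2] at h₃
    have hu : (P (e i)).part u = Y i := ((P (e i)).part_eq_iff _ _).2 ⟨h₁, h₃⟩
    have hv : (P (e i)).part v = X i := ((P (e i)).part_eq_iff _ _).2 ⟨h₄, h₅⟩
    refine (hP (e i)).backDegree_le (hmono i i.2) ?_ ?_ ?_
    · rw [hu, hv]
      exact (hpart i i.2).imp Eq.symm And.left
    · rw [hu, hv]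
      exact hδ i i.2
    · rw [hu, hv]
      exact h₆

/-- The embedding of two coordinates. -/
def pairEmb {p q : Fin k} (h : p < q) : Fin 2 ↪o Fin k :=
  OrderEmbedding.ofStrictMono ![p, q] <| by
    intro a b hab
    fin_cases a <;> fin_cases b <;> first | exact h | exact absurd hab (by decide)

theorem notMem_range_pairEmb {p q : Fin k} (h : p < q) {i : Fin k} :
    i ∉ Set.range (pairEmb h) ↔ i ≠ p ∧ i ≠ q := by
  have h₀ : pairEmb h 0 = p := rfl
  have h₁ : pairEmb h 1 = q := rfl
  constructor
  · intro hi
    exact ⟨fun hp => hi ⟨0, h₀.trans hp.symm⟩, fun hq => hi ⟨1, h₁.trans hq.symm⟩⟩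
  · rintro ⟨hp, hq⟩ ⟨j, rfl⟩
    fin_cases j
    · exact hp h₀
    · exact hq h₁

end DifferentBlocks

/-! ### Induction on the number of factors -/

section Step

variable {d : ℕ} {V : Fin d → Type u} [∀ i, Fintype (V i)]
  {η : ∀ i, V i ≃ Fin (Fintype.card (V i))} {G : ∀ i, SimpleGraph (V i)}
  {P : ∀ i, OrderedPartition (η i)} {m : ℕ} {e : Fin (m + 1) ↪o Fin d}

/-- The absence of vertices linking x to y fixes the relative place of the two blocks so tightly
that `exists_improvement_of_blocks` applies to a suitable plane. -/
theorem exists_improvement_of_different_blocks (D : DominationCollection G P) (hm : 2 ≤ m)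
    (hP : ∀ i, (P i).IsIsoperimetric (G i))
    (hmono : ∀ i : Fin d, (i : ℕ) + 1 < d → (P i).IsNonDecreasing (G i))
    (hreg : ∀ i : Fin d, 0 < (i : ℕ) → (i : ℕ) + 1 < d → (P i).IsRegular (G i))
    (hpair : ∀ e : Fin 2 ↪o Fin d, IsOptimalOrder (boxPi fun j => G (e j)) (blockLexLT D e))
    {A : Finset (∀ j, V (e j))}
    (hA : ∀ z z', (∃ i, z i = z' i) → blockLexLT D e z z' → z' ∈ A → z ∈ A)
    {x y : ∀ j, V (e j)} (hxA : x ∉ A) (hyA : y ∈ A)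
    (hx : ∀ z, blockLexLT D e z x → z ∈ A) (hy : ∀ z, blockLexLT D e y z → z ∉ A)
    (hxy : toLex (partIndex P e x) < toLex (partIndex P e y)) :
    ∃ A' : Finset (∀ j, V (e j)), #A' = #A ∧
      numInduced (boxPi fun j => G (e j)) A ≤ numInduced (boxPi fun j => G (e j)) A' ∧
      ∑ z ∈ A', position (blockLexLT D e) z < ∑ z ∈ A, position (blockLexLT D e) z := by
  -- no vertex between `x` and `y` has coordinates in common with both
  have hno : ∀ z, toLex (partIndex P e x) < toLex (partIndex P e z) →
      toLex (partIndex P e z) < toLex (partIndex P e y) → (∃ i, z i = x i) →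
      (∃ i, z i = y i) → False := by
    intro z h₁ h₂ ⟨i, hi⟩ h₃
    exact hxA (hA x z ⟨i, hi.symm⟩ (blockLexLT_of_partIndex D h₁)
      (hA z y h₃ (blockLexLT_of_partIndex D h₂) hyA))
  -- The plane always contains the last coordinate of the subproduct, so every coordinate outside it
  -- belongs to a factor other than the last one, where `hmono` is available.
  have hlast : ∀ i : Fin (m + 1), i ≠ Fin.last m → ((e i : Fin d) : ℕ) + 1 < d := fun i hi => by
    have h₁ := Fin.lt_def.1 (e.strictMono (Fin.lt_last_iff_ne_last.2 hi))
    have := (e (Fin.last m)).2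
    omega
  obtain ⟨j, hj, hjlt⟩ := hxy
  replace hj : ∀ i < j, partIndex P e x i = partIndex P e y i := hj
  replace hjlt : partIndex P e x j < partIndex P e y j := hjlt
  -- If a part lay strictly between, a vertex with its coordinate j there could take coordinate a
  -- from x and a third coordinate b from y. Taking a from x is harmless: before j the part numbers
  -- of x and y agree, and after j they no longer matter.
  have hsucc : partIndex P e y j = partIndex P e x j + 1 := by
    by_contra hcon
    have h₁ : partIndex P e x j + 1 < partIndex P e y j := by omega
    obtain ⟨v, hv⟩ := (P (e j)).surj ⟨partIndex P e x j + 1, h₁.trans ((P (e j)).part (y j)).2⟩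
    have hv' : ((P (e j)).part v : ℕ) = partIndex P e x j + 1 := congrArg Fin.val hv
    obtain ⟨a, ha⟩ : ∃ a, a ≠ j := ⟨j + 1, by
      have : Nontrivial (Fin (m + 1)) := Fin.nontrivial_iff_two_le.2 (by omega)
      simp; omega⟩
    obtain ⟨b, hb⟩ : ∃ b, b ∉ ({j, a} : Finset (Fin (m + 1))) := by
      by_contra! hall
      have h₂ := card_le_card (fun b _ => hall b : (univ : Finset (Fin (m + 1))) ⊆ {j, a})
      have h₃ := card_le_two (a := j) (b := a)
      rw [card_univ, Fintype.card_fin] at h₂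
      omega
    simp only [mem_insert, mem_singleton, not_or] at hb
    have hp : ∀ i < j, partIndex P e (Function.update (Function.update y a (x a)) j v) i =
        partIndex P e y i := by
      intro i hi
      rw [partIndex_update, Function.update_of_ne hi.ne, partIndex_update]
      by_cases hia : i = a
      · subst hia
        rw [Function.update_self]
        exact hj i hi
      · rw [Function.update_of_ne hia]
    have hpj : partIndex P e (Function.update (Function.update y a (x a)) j v) j =
        partIndex P e x j + 1 := by
      rw [partIndex_update, Function.update_self, hv']
    refine hno (Function.update (Function.update y a (x a)) j v)
      ⟨j, fun i hi => (hj i hi).trans (hp i hi).symm, ?_⟩ ⟨j, fun i hi => hp i hi, ?_⟩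
      ⟨a, by simp [ha]⟩ ⟨b, by simp [hb.1, hb.2]⟩
    · exact (Nat.lt_succ_self _).trans_eq hpj.symm
    · exact hpj.trans_lt h₁
  by_cases hjl : j = Fin.last m
  · -- the plane of the first and the last coordinate
    have h0 : (0 : Fin (m + 1)) < Fin.last m := Fin.lt_def.2 (by simp; omega)
    have heq : ∀ i, i ≠ Fin.last m → partIndex P e x i = partIndex P e y i := fun i hi =>
      hj i (hjl ▸ Fin.lt_last_iff_ne_last.2 hi)
    rw [hjl] at hsucc hjlt
    -- The blocks differ in the last coordinate only, so `H` consists of the pairs of part numbers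
    -- lexicographically up to that of x. Coordinate 1 lies outside the plane since there are at
    -- least three factors.
    refine exists_improvement_of_blocks D hP (f := pairEmb h0) ⟨⟨1, by omega⟩, ?_⟩
      (hpair ((pairEmb h0).trans e)) hA hxA hyA hx hy (fun i hi => ?_) (fun i hi => Or.inl ?_)
      (H := fun a b => a < partIndex P e x 0 ∨
        a = partIndex P e x 0 ∧ b ≤ partIndex P e x (Fin.last m))
      ?_ (Or.inr ⟨rfl, le_rfl⟩) ?_ ?_ ?_ ?_
    · rw [notMem_range_pairEmb]
      exact ⟨by simp [Fin.ext_iff], by simp only [ne_eq, Fin.ext_iff, Fin.val_last]; omega⟩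
    · exact hmono _ (hlast i ((notMem_range_pairEmb h0).1 hi).2)
    · exact Fin.ext (heq i ((notMem_range_pairEmb h0).1 hi).2)
    · intro a b a' b' h₁ h₂
      omega
    · have h₁ := heq 0 h0.ne
      change ¬ (partIndex P e y 0 < _ ∨ partIndex P e y 0 = _ ∧ partIndex P e y (Fin.last m) ≤ _)
      omega
    · intro a h₁ ⟨i, hi, hne⟩ hH
      replace hH : ¬ (a 0 < _ ∨ a 0 = _ ∧ a (Fin.last m) ≤ _) := hH
      simp only [notMem_range_pairEmb] at h₁ hi
      refine toLex_lt_of_forall_lt (L := Fin.last m) (fun l hl => ?_)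
        ⟨i, Fin.lt_last_iff_ne_last.2 hi.2, hne⟩
      by_cases hl0 : l = 0
      · subst hl0
        have := heq 0 h0.ne
        omega
      · exact h₁ l ⟨hl0, hl.ne⟩
    · intro a h₁ ⟨i, hi, hne⟩ hH
      replace hH : a 0 < _ ∨ a 0 = _ ∧ a (Fin.last m) ≤ _ := hH
      simp only [notMem_range_pairEmb] at h₁ hi
      refine toLex_lt_of_forall_lt (L := Fin.last m) (fun l hl => ?_)
        ⟨i, Fin.lt_last_iff_ne_last.2 hi.2, hne⟩
      by_cases hl0 : l = 0
      · subst hl0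
        omega
      · exact h₁ l ⟨hl0, hl.ne⟩
    · intro a b h₁ h₂ hHa hHb
      replace hHa : a 0 < _ ∨ a 0 = _ ∧ a (Fin.last m) ≤ _ := hHa
      replace hHb : ¬ (b 0 < _ ∨ b 0 = _ ∧ b (Fin.last m) ≤ _) := hHb
      simp only [notMem_range_pairEmb] at h₁ h₂
      have hab : ∀ l, l ≠ 0 → l ≠ Fin.last m → a l = b l := fun l h h' =>
        (h₁ l ⟨h, h'⟩).trans ((heq l h').trans (h₂ l ⟨h, h'⟩).symm)
      by_cases hab0 : a 0 = b 0
      · refine ⟨Fin.last m, fun l hl => ?_, ?_⟩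
        · by_cases hl0 : l = 0
          · rw [hl0]; exact hab0
          · exact hab l hl0 hl.ne
        · change a (Fin.last m) < b (Fin.last m)
          omega
      · refine ⟨0, fun l hl => absurd hl (Fin.not_lt_zero l), ?_⟩
        change a 0 < b 0
        omega
  · -- the plane of the coordinate `j` and the last coordinate
    have hjl' : j < Fin.last m := Fin.lt_last_iff_ne_last.2 hjl
    -- Otherwise lower y to the first part at i and take the last coordinate from x, or raise x by
    -- one part at i and take the last coordinate from y. The result lies between the two blocks and
    -- shares coordinates with both, as the last coordinate comes too late to affect the comparison.
    have hafter : ∀ i, j < i → i ≠ Fin.last m → partIndex P e y i = 0 ∧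
        partIndex P e x i + 1 = (P (e i)).numParts := by
      intro i hji hil
      have hil' := Fin.lt_last_iff_ne_last.2 hil
      constructor
      · by_contra hcon
        obtain ⟨v, hv⟩ := (P (e i)).surj ⟨0, (Nat.zero_le _).trans_lt ((P (e i)).part (y i)).2⟩
        have hv' : ((P (e i)).part v : ℕ) = 0 := congrArg Fin.val hv
        have hp : ∀ l < i, partIndex P e (Function.update (Function.update y i v) (Fin.last m)
            (x (Fin.last m))) l = partIndex P e y l := fun l hl => by
          rw [partIndex_update, Function.update_of_ne (hl.trans hil').ne, partIndex_update,
            Function.update_of_ne hl.ne]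
        refine hno (Function.update (Function.update y i v) (Fin.last m) (x (Fin.last m)))
          ⟨j, fun l hl => (hj l hl).trans (hp l (hl.trans hji)).symm,
            hjlt.trans_eq (hp j hji).symm⟩ ⟨i, fun l hl => hp l hl, ?_⟩
          ⟨Fin.last m, by simp⟩ ⟨j, by simp [hjl, hji.ne]⟩
        change partIndex P e _ i < partIndex P e y i
        rw [partIndex_update, Function.update_of_ne hil, partIndex_update, Function.update_self, hv']
        omega
      · by_contra hcon
        have hlt : partIndex P e x i < (P (e i)).numParts := ((P (e i)).part (x i)).2
        obtain ⟨v, hv⟩ := (P (e i)).surj ⟨partIndex P e x i + 1, by omega⟩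
        have hv' : ((P (e i)).part v : ℕ) = partIndex P e x i + 1 := congrArg Fin.val hv
        have hp : ∀ l < i, partIndex P e (Function.update (Function.update x i v) (Fin.last m)
            (y (Fin.last m))) l = partIndex P e x l := fun l hl => by
          rw [partIndex_update, Function.update_of_ne (hl.trans hil').ne, partIndex_update,
            Function.update_of_ne hl.ne]
        refine hno (Function.update (Function.update x i v) (Fin.last m) (y (Fin.last m)))
          ⟨i, fun l hl => (hp l hl).symm, ?_⟩
          ⟨j, fun l hl => (hp l (hl.trans hji)).trans (hj l hl), (hp j hji).trans_lt hjlt⟩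
          ⟨j, by simp [hjl, hji.ne]⟩ ⟨Fin.last m, by simp⟩
        change partIndex P e x i < partIndex P e _ i
        rw [partIndex_update, Function.update_of_ne hil, partIndex_update, Function.update_self, hv']
        omega
    -- Coordinate j alone separates the blocks, so `H` ignores the last coordinate. Coordinates
    -- before j agree in their parts, and those between j and the last pass from the last part to
    -- the first.
    refine exists_improvement_of_blocks D hP (f := pairEmb hjl') ?_
      (hpair ((pairEmb hjl').trans e)) hA hxA hyA hx hy (fun i hi => ?_) (fun i hi => ?_)
      (H := fun a _ => a ≤ partIndex P e x j) ?_ le_rfl hjlt.not_ge ?_ ?_ ?_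
    · by_contra! hall
      have h₂ : (univ : Finset (Fin (m + 1))) ⊆ {j, Fin.last m} := fun b _ => by
        by_contra hb
        simp only [mem_insert, mem_singleton, not_or] at hb
        exact (notMem_range_pairEmb hjl').2 hb (hall b)
      have h₃ := card_le_card h₂
      have h₄ := card_le_two (a := j) (b := Fin.last m)
      rw [card_univ, Fintype.card_fin] at h₃
      omega
    · exact hmono _ (hlast i ((notMem_range_pairEmb hjl').1 hi).2)
    · rw [notMem_range_pairEmb] at hi
      rcases lt_or_gt_of_ne hi.1 with h | h
      · exact Or.inl (Fin.ext (hj i h))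
      · obtain ⟨h₁, h₂⟩ := hafter i h hi.2
        refine Or.inr ⟨h₁, h₂, hreg _ ?_ (hlast i hi.2)⟩
        have := Fin.lt_def.1 (e.strictMono h)
        omega
    · intro a b a' b' h₁ h₂
      omega
    · intro a h₁ ⟨i, hi, hne⟩ hH
      replace hH : ¬ a j ≤ _ := hH
      simp only [notMem_range_pairEmb] at h₁ hi
      refine toLex_lt_of_forall_lt (L := Fin.last m) (fun l hl => ?_)
        ⟨i, Fin.lt_last_iff_ne_last.2 hi.2, hne⟩
      by_cases hlj : l = j
      · subst hlj
        omega
      · exact h₁ l ⟨hlj, hl.ne⟩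
    · intro a h₁ ⟨i, hi, hne⟩ hH
      replace hH : a j ≤ _ := hH
      simp only [notMem_range_pairEmb] at h₁ hi
      refine toLex_lt_of_forall_lt (L := Fin.last m) (fun l hl => ?_)
        ⟨i, Fin.lt_last_iff_ne_last.2 hi.2, hne⟩
      by_cases hlj : l = j
      · subst hlj
        exact hH
      · exact h₁ l ⟨hlj, hl.ne⟩
    · intro a b h₁ h₂ hHa hHb
      replace hHa : a j ≤ _ := hHa
      replace hHb : ¬ b j ≤ _ := hHb
      simp only [notMem_range_pairEmb] at h₁ h₂
      refine ⟨j, fun l hl => ?_, hHa.trans_lt (not_le.1 hHb)⟩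
      exact (h₁ l ⟨hl.ne, (hl.trans hjl').ne⟩).trans
        ((hj l hl).trans (h₂ l ⟨hl.ne, (hl.trans hjl').ne⟩).symm)

/-- The step from `m` to `m + 1` factors. -/
theorem isOptimalOrder_blockLexLT_succ (D : DominationCollection G P) (hm : 2 ≤ m)
    (hP : ∀ i, (P i).IsIsoperimetric (G i))
    (hmono : ∀ i : Fin d, (i : ℕ) + 1 < d → (P i).IsNonDecreasing (G i))
    (hreg : ∀ i : Fin d, 0 < (i : ℕ) → (i : ℕ) + 1 < d → (P i).IsRegular (G i))
    (hpair : ∀ e : Fin 2 ↪o Fin d, IsOptimalOrder (boxPi fun j => G (e j)) (blockLexLT D e))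
    (h : ∀ e : Fin m ↪o Fin d, IsOptimalOrder (boxPi fun j => G (e j)) (blockLexLT D e)) :
    IsOptimalOrder (boxPi fun j => G (e j)) (blockLexLT D e) := by
  have hst := isStrictTotalOrder_blockLexLT D (e := e)
  refine isOptimalOrder_of_improvement hst fun A ⟨a, b, hab, hb, ha⟩ => ?_
  by_cases hA : ∃ z z', (∃ i, z i = z' i) ∧ blockLexLT D e z z' ∧ z' ∈ A ∧ z ∉ A
  · exact exists_improvement_of_not_compressed D (by omega) h hA
  replace hA : ∀ z z', (∃ i, z i = z' i) → blockLexLT D e z z' → z' ∈ A → z ∈ A := by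
    intro z z' h₁ h₂ h₃
    by_contra hcon
    exact hA ⟨z, z', h₁, h₂, h₃, hcon⟩
  obtain ⟨x, hx, hxmin⟩ := exists_min_image (univ \ A) (position (blockLexLT D e)) ⟨a, by simpa⟩
  obtain ⟨y, hy, hymax⟩ := exists_max_image A (position (blockLexLT D e)) ⟨b, hb⟩
  simp only [mem_sdiff, mem_univ, true_and] at hx hxmin
  have hxy : blockLexLT D e x y :=
    position_lt_iff.1 ((hxmin a ha).trans_lt ((position_lt hab).trans_le (hymax b hb)))
  have hx' : ∀ z, blockLexLT D e z x → z ∈ A := by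
    intro z hz
    by_contra hcon
    exact absurd (hxmin z hcon) (position_lt hz).not_ge
  have hy' : ∀ z, blockLexLT D e y z → z ∉ A := fun z hz hcon =>
    absurd (hymax z hcon) (position_lt hz).not_ge
  by_cases hblock : blockOf P e x = blockOf P e y
  · exact exists_improvement_of_same_block D (Nat.succ_pos m) hP hx hy hxy hblock hx' hy'
  · refine exists_improvement_of_different_blocks D hm hP hmono hreg hpair hA hx hy hx' hy'
      (lt_of_le_of_ne (partIndex_le_of_blockLexLT D hxy) fun h => hblock ?_)
    exact blockOf_eq_iff.2 (toLex.injective h)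

theorem isOptimalOrder_blockLexLT (D : DominationCollection G P)
    (hP : ∀ i, (P i).IsIsoperimetric (G i))
    (hmono : ∀ i : Fin d, (i : ℕ) + 1 < d → (P i).IsNonDecreasing (G i))
    (hreg : ∀ i : Fin d, 0 < (i : ℕ) → (i : ℕ) + 1 < d → (P i).IsRegular (G i))
    (hpair : ∀ e : Fin 2 ↪o Fin d, IsOptimalOrder (boxPi fun j => G (e j)) (blockLexLT D e))
    {k : ℕ} (hk : 2 ≤ k) (e : Fin k ↪o Fin d) :
    IsOptimalOrder (boxPi fun j => G (e j)) (blockLexLT D e) := by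
  induction k, hk using Nat.le_induction with
  | base => exact hpair e
  | succ m hm ih => exact isOptimalOrder_blockLexLT_succ D hm hP hmono hreg hpair ih

end Step

end EdgeIso

theorem mainTheorem1 {d : ℕ} (hd : 3 ≤ d) {V : Fin d → Type*} [∀ i, Fintype (V i)]
    (G : ∀ i, SimpleGraph (V i)) (η : ∀ i, V i ≃ Fin (Fintype.card (V i)))
    (hη : ∀ i, IsOptimalOrder (G i) (rankLT (η i)))
    (P : ∀ i, OrderedPartition (η i)) (hP : ∀ i, (P i).IsIsoperimetric (G i))
    (hmono : ∀ i : Fin d, (i : ℕ) + 1 < d → (P i).IsNonDecreasing (G i))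
    (D : DominationCollection G P) (hD : D.IsRegular)
    (hpair : ∀ e : Fin 2 ↪o Fin d, IsOptimalOrder (boxPi fun j => G (e j)) (blockLexLT D e)) :
    IsOptimalOrder (boxPi G) (blockLexLT D (RelEmbedding.refl (· ≤ ·))) :=
  isOptimalOrder_blockLexLT D hP hmono hD.regular hpair (by omega) (RelEmbedding.refl (· ≤ ·))
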